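/- **Setting.** Let $\mathfrak X$ be a measurable space with a probability measure $\mathbf P_0$. Hypothesis $H_0$: for every $n$ the tested elements $\varepsilon_1,\dots,\varepsilon_n$ are independent with distribution $\mathbf P_0$ (for different $n$ they may live on different probability spaces). Expectations $\mathbf E$, variances $\mathbf D$, covariances and probabilities $\mathbf P$ without further mention are computed for an infinite sequence $\varepsilon_1,\varepsilon_2,\dots$ of independent elements with distribution $\mathbf P_0$. $[\cdot]$ is the integer part, and $o_P(1)$ denotes random variables that tend to zero in probability. Fix positive integers $m_{sum},m_{lb},N_{lb},L_{sb},K_{sb}$, measurable functions $f_{sum}:\mathfrak X^{m_{sum}}\to\mathbb R$, $f_{lb}:\mathfrak X^{m_{lb}}\to\mathbb R$, $f_{sb}:\mathfrak X^{L_{sb}}\to\mathbb R$ and a partition of the set of values of $f_{sb}$ into nonempty disjoint sets $\alpha_{sb}(0),\dots,\alpha_{sb}(K_{sb})$ with measurable preimages. The functions $f_{sum}$ and $f_{lb}$ need not be bounded. For $\bullet\in\{sum,lb\}$ put $$E_\bullet=\mathbf E f_\bullet(\varepsilon_1,\dots,\varepsilon_{m_\bullet}),\qquad \sigma_\bullet^2=\mathbf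 D f_\bullet(\varepsilon_1,\dots,\varepsilon_{m_\bullet})+2\sum_{i=2}^{m_\bullet}\mathrm{cov}\big(f_\bullet(\varepsilon_i,\dots,\varepsilon_{i+m_\bullet-1}),f_\bullet(\varepsilon_1,\dots,\varepsilon_{m_\bullet})\big),\quad \sigma_\bullet\ge 0,$$ and $E_{sb}(j)=\mathbf P(f_{sb}(\varepsilon_1,\dots,\varepsilon_{L_{sb}})\in\alpha_{sb}(j))$. Assume that these quantities are well defined, in particular that $f_{sum}(\varepsilon_1,\dots,\varepsilon_{m_{sum}})$ and $f_{lb}(\varepsilon_1,\dots,\varepsilon_{m_{lb}})$ have finite variances, and that $\sigma_{sum},\sigma_{lb}\in(0,\infty)$ and $E_{sb}(j)>0$ for $0\le j\le K_{sb}$. Let $L_{lb}=[n/N_{lb}]$, $N_{sb}=[n/L_{sb}]$, $$W_k=\sum_{j=L_{lb}(k-1)+1}^{L_{lb}k-m_{lb}+1}f_{lb}(\varepsilon_j,\dots,\varepsilon_{j+m_{lb}-1}),\qquad w(j)=\sum_{i=1}^{N_{sb}}I\{f_{sb}(\varepsilon_{L_{sb}(i-1)+1},\dots,\varepsilon_{L_{sb}i})\in\alpha_{sb}(j)\},$$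 $$T_{sum}=\frac{\sum_{i=1}^{n-m_{sum}+1}\big(f_{sum}(\varepsilon_i,\dots,\varepsilon_{i+m_{sum}-1})-E_{sum}\big)}{\sigma_{sum}\sqrt{n-m_{sum}+1}},\quad T_{lb}=\frac{\sum_{k=1}^{N_{lb}}\big(W_k-(L_{lb}-m_{lb}+1)E_{lb}\big)^2}{L_{lb}\sigma_{lb}^2},\quad T_{sb}=\sum_{j=0}^{K_{sb}}\frac{(w(j)-N_{sb}E_{sb}(j))^2}{N_{sb}E_{sb}(j)}.$$ Fix positive integers $N,s,h$ with $N_{lb}\mid N$, $L_{sb}\mid h$ and $s\ge h+\max(m_{sum},m_{lb})-1$; let $L=[n/N]$. For $i\ge1$ let $Z_i=(Z_i(0),\dots,Z_i(K_{sb}+2))$, where, with $\theta_u=\varepsilon_{h(i-1)+u}$, $$Z_i(j)=\frac1{\sqrt{E_{sb}(j)}}\sum_{u=1}^{h/L_{sb}}I\{f_{sb}(\theta_{L_{sb}(u-1)+1},\dots,\theta_{L_{sb}u})\in\alpha_{sb}(j)\}\quad(0\le j\le K_{sb}),$$ $$Z_i(K_{sb}+1)=\frac1{\sigma_{lb}}\sum_{u=1}^h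 f_{lb}(\theta_u,\dots,\theta_{u+m_{lb}-1}),\qquad Z_i(K_{sb}+2)=\frac1{\sigma_{sum}}\sum_{u=1}^h f_{sum}(\theta_u,\dots,\theta_{u+m_{sum}-1}).$$ Put $$\Phi=\mathbf D Z_1+\sum_{2\le i\le\frac{s-1}h+1}\Big(\mathrm{cov}(Z_1,Z_i)+\mathrm{cov}(Z_1,Z_i)^{\top}\Big),$$ $$\mathcal X_k=\frac1{\sqrt n}\sum_{\frac{L(k-1)}h\le i\le\frac{Lk-s}h}\big(Z_{i+1}-\mathbf E Z_1\big)\ (1\le k\le N),\qquad \mathcal Y_k=\sum_{i=1}^{N/N_{lb}}\mathcal X_{\frac N{N_{lb}}(k-1)+i}\ (1\le k\le N_{lb}).$$ **Statement.** Let $H_0$ hold and let all the parameters above be fixed. Let $\eta_1,\dots,\eta_N$ be independent $(K_{sb}+3)$-dimensional random vectors with $\eta_k\sim\mathcal N\big(0,\frac1{Nh}\Phi\big)$, and let $\zeta_k=\sum_{i=1}^{N/N_{lb}}\eta_{\frac N{N_{lb}}(k-1)+i}$ for $1\le k\le N_{lb}$. Then $\Phi$ is symmetric and nonnegative definite, the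 vectors $\zeta_1,\dots,\zeta_{N_{lb}}$ are independent, $\zeta_k\sim\mathcal N\big(0,\frac1{hN_{lb}}\Phi\big)$ for $1\le k\le N_{lb}$, and, as $n\to\infty$, $$T_{sum}=\sum_{k=1}^{N_{lb}}\mathcal Y_k(K_{sb}+2)+o_P(1),\qquad T_{lb}=N_{lb}\sum_{k=1}^{N_{lb}}\big(\mathcal Y_k(K_{sb}+1)\big)^2+o_P(1),$$ $$T_{sb}=L_{sb}\sum_{j=0}^{K_{sb}}\Big(\sum_{k=1}^{N_{lb}}\mathcal Y_k(j)\Big)^2+o_P(1),\qquad (\mathcal Y_1,\dots,\mathcal Y_{N_{lb}})\xrightarrow{d}(\zeta_1,\dots,\zeta_{N_{lb}}),$$ $$(T_{sum},T_{lb},T_{sb})\xrightarrow{d}\Bigg(\sum_{k=1}^{N_{lb}}\zeta_k(K_{sb}+2),\ N_{lb}\sum_{k=1}^{N_{lb}}\zeta_k(K_{sb}+1)^2,\ L_{sb}\sum_{j=0}^{K_{sb}}\Big(\sum_{k=1}^{N_{lb}}\zeta_k(j)\Big)^2\Bigg).$$ -/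

import Mathlib

open MeasureTheory ProbabilityTheory Filter Topology
open scoped Matrix

noncomputable section

/-- The parameters of the summing, long-block and short-block statistics for a tested sequence with
values in `𝔛`. -/
structure StatParams (𝔛 : Type*) where
  mSum : ℕ
  mLb : ℕ
  Nlb : ℕ
  Lsb : ℕ
  Ksb : ℕ
  fSum : (Fin mSum → 𝔛) → ℝ
  fLb : (Fin mLb → 𝔛) → ℝ
  fSb : (Fin Lsb → 𝔛) → ℝ
  αSb : Fin (Ksb + 1) → Set ℝ

/-- The chain of length `m` that starts right after the first `j` elements. A tested sequence
`ε₁, ε₂, …` is written with indices from `0`, that is `x 0 = ε₁`, `x 1 = ε₂`, …, so that this is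
`(ε_{j+1}, …, ε_{j+m})`. -/
def chain {𝔛 : Type*} (m j : ℕ) (x : ℕ → 𝔛) : Fin m → 𝔛 := fun i => x (j + i)

/-- The law of an infinite sequence of independent elements with distribution `P₀`. Expectations,
variances, covariances and probabilities "under `H₀`" are computed with respect to it. -/
def lawH0 {𝔛 : Type*} [MeasurableSpace 𝔛] (P₀ : Measure 𝔛) [IsProbabilityMeasure P₀] :
    Measure (ℕ → 𝔛) := Measure.infinitePi fun _ => P₀

/-- `E f(ε₁, …, ε_m)` under `H₀`. -/
def meanH0 {𝔛 : Type*} [MeasurableSpace 𝔛] (P₀ : Measure 𝔛) [IsProbabilityMeasure P₀]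
    {m : ℕ} (f : (Fin m → 𝔛) → ℝ) : ℝ := ∫ x, f (chain m 0 x) ∂(lawH0 P₀)

/-- `D f(ε₁, …, ε_m) + 2 ∑_{i=2}^{m} cov(f(ε_i, …, ε_{i+m-1}), f(ε₁, …, ε_m))` under `H₀`,
with `i = r + 1`. -/
def sigmaSqH0 {𝔛 : Type*} [MeasurableSpace 𝔛] (P₀ : Measure 𝔛) [IsProbabilityMeasure P₀]
    {m : ℕ} (f : (Fin m → 𝔛) → ℝ) : ℝ :=
  variance (fun x => f (chain m 0 x)) (lawH0 P₀) +
    2 * ∑ r ∈ Finset.Ico 1 m,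
      covariance (fun x => f (chain m r x)) (fun x => f (chain m 0 x)) (lawH0 P₀)

/-- The nonnegative square root of `sigmaSqH0`. -/
def sigmaH0 {𝔛 : Type*} [MeasurableSpace 𝔛] (P₀ : Measure 𝔛) [IsProbabilityMeasure P₀]
    {m : ℕ} (f : (Fin m → 𝔛) → ℝ) : ℝ := √(sigmaSqH0 P₀ f)

/-- The matrix `cov(X, Y)` of two random vectors. -/
def crossCov {Ω : Type*} [MeasurableSpace Ω] {d : ℕ} (μ : Measure Ω)
    (X Y : Ω → EuclideanSpace ℝ (Fin d)) : Matrix (Fin d) (Fin d) ℝ :=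
  Matrix.of fun a b => covariance (fun ω => X ω a) (fun ω => Y ω b) μ

/-- Sums over `Nlb` groups of `N / Nlb` consecutive vectors; vectors and groups are numbered
from `0`. -/
def groupSum {E : Type*} [AddCommMonoid E] (N Nlb : ℕ) (v : ℕ → E) (k : ℕ) : E :=
  ∑ i ∈ Finset.range (N / Nlb), v (N / Nlb * k + i)

namespace StatParams

variable {𝔛 : Type*} [MeasurableSpace 𝔛] (p : StatParams 𝔛)
  (P₀ : Measure 𝔛) [IsProbabilityMeasure P₀]

/-- `E_sb(j)`. -/
def Esb (j : Fin (p.Ksb + 1)) : ℝ :=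
  (lawH0 P₀).real {x | p.fSb (chain p.Lsb 0 x) ∈ p.αSb j}

/-- The standing assumptions on the parameters: the numbers are positive, the functions are
measurable, the sets `αSb j` partition the set of values of `fSb` into nonempty subsets, and the
three statistics are well defined (finite variances, positive finite `σ_sum`, `σ_lb`, and
`E_sb(j) > 0`). -/
structure WellDefined : Prop where
  mSum_pos : 0 < p.mSum
  mLb_pos : 0 < p.mLb
  Nlb_pos : 0 < p.Nlb
  Lsb_pos : 0 < p.Lsb
  measurable_fSum : Measurable p.fSum
  measurable_fLb : Measurable p.fLb
  measurableSet_αSb : ∀ j, MeasurableSet (p.fSb ⁻¹' p.αSb j)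
  αSb_nonempty : ∀ j, (p.αSb j).Nonempty
  αSb_disjoint : Pairwise fun i j => Disjoint (p.αSb i) (p.αSb j)
  αSb_union : ⋃ j, p.αSb j = Set.range p.fSb
  memLp_fSum : MemLp p.fSum 2 (Measure.pi fun _ => P₀)
  memLp_fLb : MemLp p.fLb 2 (Measure.pi fun _ => P₀)
  sigmaSum_pos : 0 < sigmaH0 P₀ p.fSum
  sigmaLb_pos : 0 < sigmaH0 P₀ p.fLb
  Esb_pos : ∀ j, 0 < p.Esb P₀ j

/-- The summing statistic. -/
def Tsum (n : ℕ) (x : ℕ → 𝔛) : ℝ :=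
  (∑ i ∈ Finset.range (n + 1 - p.mSum), (p.fSum (chain p.mSum i x) - meanH0 P₀ p.fSum)) /
    (sigmaH0 P₀ p.fSum * √((n : ℝ) - p.mSum + 1))

/-- `L_lb = [n / N_lb]`. -/
def Llb (n : ℕ) : ℕ := n / p.Nlb

/-- `N_sb = [n / L_sb]`. -/
def Nsb (n : ℕ) : ℕ := n / p.Lsb

/-- The sum `W_{k+1}` over the long block with number `k + 1`. -/
def W (n k : ℕ) (x : ℕ → 𝔛) : ℝ :=
  ∑ j ∈ Finset.Ico (p.Llb n * k) (p.Llb n * (k + 1) + 1 - p.mLb), p.fLb (chain p.mLb j x)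

/-- The long-block statistic. -/
def Tlb (n : ℕ) (x : ℕ → 𝔛) : ℝ :=
  (∑ k ∈ Finset.range p.Nlb,
      (p.W n k x - ((p.Llb n : ℝ) - p.mLb + 1) * meanH0 P₀ p.fLb) ^ 2) /
    (p.Llb n * sigmaH0 P₀ p.fLb ^ 2)

/-- The number `w(j)` of short blocks with `f_sb` in `α_sb(j)`. -/
def w (n : ℕ) (j : Fin (p.Ksb + 1)) (x : ℕ → 𝔛) : ℝ :=
  ∑ i ∈ Finset.range (p.Nsb n), (p.αSb j).indicator 1 (p.fSb (chain p.Lsb (p.Lsb * i) x))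

/-- The short-block statistic. -/
def Tsb (n : ℕ) (x : ℕ → 𝔛) : ℝ :=
  ∑ j, (p.w n j x - p.Nsb n * p.Esb P₀ j) ^ 2 / (p.Nsb n * p.Esb P₀ j)

/-- `s̲ = h + max(m_sum, m_lb) - 1`. -/
def sMin (h : ℕ) : ℕ := h + max p.mSum p.mLb - 1

/-- The coordinate `K_sb + 1`. -/
def idxLb : Fin (p.Ksb + 3) := ⟨p.Ksb + 1, by omega⟩

/-- The coordinate `K_sb + 2`. -/
def idxSum : Fin (p.Ksb + 3) := ⟨p.Ksb + 2, by omega⟩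

/-- The coordinates `0, …, K_sb`. -/
def idxSb (j : Fin (p.Ksb + 1)) : Fin (p.Ksb + 3) := ⟨j, by omega⟩

/-- The vector function `f^{(s)}(θ₁, …, θ_s)`, `θ_i` being `θ (i - 1)`. If `L_sb` divides `h`, it
depends on the sequence `θ` through its first `s̲` elements only; it is the same for all
`s ≥ s̲`. -/
def fVec (h : ℕ) (θ : ℕ → 𝔛) : EuclideanSpace ℝ (Fin (p.Ksb + 3)) :=
  WithLp.toLp 2 fun j =>
    if hj : (j : ℕ) < p.Ksb + 1 then
      1 / √(p.Esb P₀ ⟨j, hj⟩) * ∑ u ∈ Finset.range (h / p.Lsb),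
        (p.αSb ⟨j, hj⟩).indicator 1 (p.fSb (chain p.Lsb (p.Lsb * u) θ))
    else if (j : ℕ) = p.Ksb + 1 then
      (sigmaH0 P₀ p.fLb)⁻¹ * ∑ u ∈ Finset.range h, p.fLb (chain p.mLb u θ)
    else
      (sigmaH0 P₀ p.fSum)⁻¹ * ∑ u ∈ Finset.range h, p.fSum (chain p.mSum u θ)

/-- The vector `Z_{i+1}`, that is `f^{(s)}(ε_{hi+1}, …, ε_{hi+s})`. -/
def Z (h i : ℕ) (x : ℕ → 𝔛) : EuclideanSpace ℝ (Fin (p.Ksb + 3)) :=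
  p.fVec P₀ h fun t => x (h * i + t)

/-- `E Z₁` under `H₀`, coordinate by coordinate. -/
def meanZ (h : ℕ) : EuclideanSpace ℝ (Fin (p.Ksb + 3)) :=
  WithLp.toLp 2 fun j => ∫ x, p.Z P₀ h 0 x j ∂(lawH0 P₀)

/-- `Φ = D Z₁ + ∑_{2 ≤ i ≤ (s-1)/h+1} (cov(Z₁, Z_i) + cov(Z₁, Z_i)ᵀ)` under `H₀`,
with `i = r + 1`. -/
def Φ (s h : ℕ) : Matrix (Fin (p.Ksb + 3)) (Fin (p.Ksb + 3)) ℝ :=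
  crossCov (lawH0 P₀) (p.Z P₀ h 0) (p.Z P₀ h 0) +
    ∑ r ∈ Finset.Icc 1 ((s - 1) / h),
      (crossCov (lawH0 P₀) (p.Z P₀ h 0) (p.Z P₀ h r) +
        (crossCov (lawH0 P₀) (p.Z P₀ h 0) (p.Z P₀ h r))ᵀ)

/-- The vector `𝒳_{k+1}^{(N,s,h)}`, where `L = [n / N]`: the sum is over the integers `i` with
`L k / h ≤ i ≤ (L (k + 1) - s) / h`. -/
def X (N s h n k : ℕ) (x : ℕ → 𝔛) : EuclideanSpace ℝ (Fin (p.Ksb + 3)) :=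
  (1 / √(n : ℝ)) • ∑ i ∈ (Finset.range (n / N * (k + 1) + 1)).filter
      (fun i => n / N * k ≤ h * i ∧ h * i + s ≤ n / N * (k + 1)),
    (p.Z P₀ h i x - p.meanZ P₀ h)

/-- The vector `𝒴_{k+1}^{(N,s,h)}`. -/
def Y (N s h n k : ℕ) (x : ℕ → 𝔛) : EuclideanSpace ℝ (Fin (p.Ksb + 3)) :=
  groupSum N p.Nlb (fun t => p.X P₀ N s h n t x) k

end StatParams

/-- The hypothesis `H₀` for a series scheme: for every `n` the first `n` elements
`ε n 0, …, ε n (n - 1)` of the `n`-th series are independent with distribution `P₀`; the other ones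
are arbitrary and play no role. -/
structure HypothesisH0 {𝔛 : Type*} [MeasurableSpace 𝔛] (P₀ : Measure 𝔛)
    {Ω : ℕ → Type*} [∀ n, MeasurableSpace (Ω n)] (P : ∀ n, Measure (Ω n))
    (ε : ∀ n, ℕ → Ω n → 𝔛) : Prop where
  hasLaw : ∀ n, ∀ i < n, HasLaw (ε n i) P₀ (P n)
  indep : ∀ n, iIndepFun (fun i : Fin n => ε n i) (P n)

/-- `A = B + o_P(1)` as `n → ∞`, where the `n`-th variables live on the `n`-th probability space. -/
def EqUpToSmallP {Ω : ℕ → Type*} [∀ n, MeasurableSpace (Ω n)] (P : ∀ n, Measure (Ω n))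
    (A B : ∀ n, Ω n → ℝ) : Prop :=
  ∀ δ : ℝ, 0 < δ → Tendsto (fun n => P n {ω | δ ≤ |A n ω - B n ω|}) atTop (𝓝 0)

end

/-!
All the statistics are functionals of the tested elements, and the `n`-th ones involve the first `n`
elements only. Their joint laws, and the laws of the remainders, are therefore the same as for one
infinite sequence of independent elements (`HypothesisH0.hasLaw_comp`), so the whole argument takes
place under `lawH0 P₀`.

There every coordinate of a vector `Z i - E Z 1`, and every centered summand of a statistic, is a
shift of a centered square integrable function of finitely many elements (`IsCenteredLocal`). The
shifts of such a function form a stationary sequence with finite memory: terms far enough apart are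
independent. This has two consequences.

* The second moment of the sum of `M` terms grows at most like a multiple of `M`, and divided by `M`
  it tends to the long-run variance (`IsCenteredLocal.tendsto_integral_sq_shiftSum_div`). Hence the
  long-run variance is nonnegative. For the projection of `Z 1 - E Z 1` on a vector `t` it equals
  the quadratic form of `Φ` at `t`, so `Φ` is positive semidefinite.
* The central limit theorem holds (`IsCenteredLocal.tendsto_meanExp`): long blocks of terms with
  gaps of fixed length between them are independent and identically distributed, so that Mathlib's
  central limit theorem applies to them, while the gaps contribute little in mean square. The error
  is controlled through characteristic functions.

The vectors `𝒳 k` are exactly independent, since they are functions of disjoint sets of elements,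
and by the central limit theorem for all projections each of them converges to a Gaussian vector. A
product of converging laws converges to the product of the limits, which gives the joint convergence
to `η` (`StatParams.WellDefined.tendstoInDistribution_X`) and, by continuous mapping, that of the
`𝒴 k`.

For the expansions, both a statistic and its approximation by the `𝒴 k` are built from normalized
sums of the same stationary sequence, over two index sets contained in one interval and missing only
boundedly many of its indices. After normalization such sums differ by a term that vanishes in mean
square (`IsCenteredLocal.tendsto_integral_sq_sub`), and since they are bounded in mean square, their
squares differ by a term that vanishes in mean. The limit law of the three statistics follows by
Slutsky's theorem and continuous mapping.
-/

/-! ### Functions of finitely many elements of the sequence -/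

/-- Functions of disjoint finite parts of an independent family are independent. -/
lemma ProbabilityTheory.iIndepFun.comp_finsets {Ω ι κ E : Type*} [MeasurableSpace Ω]
    [MeasurableSpace E] {μ : Measure Ω} {X : κ → Ω → E} (hX : iIndepFun X μ)
    (hm : ∀ i, AEMeasurable (X i) μ) {S : ι → Finset κ}
    (hdisj : Pairwise fun k l => Disjoint (S k) (S l)) {F : ι → Type*}
    [∀ k, MeasurableSpace (F k)] {G : ∀ k, (S k → E) → F k} (hG : ∀ k, Measurable (G k)) :
    iIndepFun (fun k ω => G k fun i => X i ω) μ := by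
  classical
  have := hX.isProbabilityMeasure
  rw [iIndepFun_iff_measure_inter_preimage_eq_mul]
  intro I
  induction I using Finset.induction_on with
  | empty => simp
  | insert a I ha ih =>
    intro A hA
    have hA' : ∀ i ∈ I, MeasurableSet (A i) := fun i hi => hA i (Finset.mem_insert_of_mem hi)
    rw [Finset.prod_insert ha, ← ih hA', Finset.set_biInter_insert]
    have hd : Disjoint (S a) (I.biUnion S) := by
      rw [Finset.disjoint_biUnion_right]
      exact fun i hi => hdisj fun h => ha (h ▸ hi)
    set B : Set (↥(I.biUnion S) → E) := ⋂ i : I,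
      (fun y => G i fun j => y ⟨j, Finset.mem_biUnion.2 ⟨i, i.2, j.2⟩⟩) ⁻¹' A i with hB
    have hBm : MeasurableSet B := MeasurableSet.iInter fun i =>
      ((hG i).comp (measurable_pi_lambda _ fun j => measurable_pi_apply _)) (hA' i i.2)
    have h := (hX.indepFun_finset₀ (S a) (I.biUnion S) hd hm).measure_inter_preimage_eq_mul
      (G a ⁻¹' A a) B ((hG a) (hA a (Finset.mem_insert_self _ _))) hBm
    have e : (⋂ i ∈ I, (fun ω => G i fun j => X j ω) ⁻¹' A i) =
        (fun ω (i : ↥(I.biUnion S)) => X i ω) ⁻¹' B := by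
      ext ω
      simp [hB]
    rw [e]
    exact h

section Sequence

variable {𝔛 : Type*}

/-- The sequence without its first `a` elements. -/
def shift (a : ℕ) (x : ℕ → 𝔛) : ℕ → 𝔛 := fun t => x (a + t)

lemma shift_shift (a b : ℕ) (x : ℕ → 𝔛) : shift a (shift b x) = shift (b + a) x := by
  ext t; simp [shift, add_assoc]

@[simp] lemma shift_zero (x : ℕ → 𝔛) : shift 0 x = x := by
  ext t; simp [shift]

lemma chain_eq_chain_shift (m j : ℕ) (x : ℕ → 𝔛) : chain m j x = chain m 0 (shift j x) := by
  ext i; simp [chain, shift]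

lemma DependsOn.comp_shift {β : Type*} {g : (ℕ → 𝔛) → β} {s : ℕ} (hg : DependsOn g (Set.Iio s))
    (a : ℕ) : DependsOn (fun x => g (shift a x)) (Finset.Ico a (a + s) : Finset ℕ) := by
  intro x y hxy
  refine hg fun t ht => hxy _ ?_
  simp only [Finset.coe_Ico, Set.mem_Ico, Set.mem_Iio] at ht ⊢
  omega

lemma dependsOn_comp_chain {β : Type*} {m : ℕ} (f : (Fin m → 𝔛) → β) :
    DependsOn (fun x => f (chain m 0 x)) (Set.Iio m) := by
  intro x y hxy
  have : chain m 0 x = chain m 0 y := by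
    ext i; simpa [chain] using hxy (0 + i) (by simp)
  simp [this]

lemma dependsOn_finset_sum {ι E : Type*} [AddCommMonoid E] (I : Finset ι) {S : Set ℕ}
    {F : ι → (ℕ → 𝔛) → E} (hF : ∀ i ∈ I, DependsOn (F i) S) :
    DependsOn (fun x => ∑ i ∈ I, F i x) S :=
  fun _ _ hxy => Finset.sum_congr rfl fun i hi => hF i hi hxy

variable [MeasurableSpace 𝔛]

@[fun_prop]
lemma measurable_shift (a : ℕ) : Measurable (shift a : (ℕ → 𝔛) → ℕ → 𝔛) := by
  unfold shift; fun_prop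

@[fun_prop]
lemma measurable_chain (m j : ℕ) : Measurable (chain m j : (ℕ → 𝔛) → Fin m → 𝔛) := by
  unfold chain; fun_prop

/-- A measurable function of finitely many elements factors measurably through them. -/
lemma DependsOn.exists_measurable_comp [Nonempty 𝔛] {E : Type*} [MeasurableSpace E]
    {F : (ℕ → 𝔛) → E} (hF : Measurable F) {S : Finset ℕ} (hS : DependsOn F S) :
    ∃ G : (S → 𝔛) → E, Measurable G ∧ ∀ x, F x = G fun i => x i := by
  classical
  obtain ⟨x₀⟩ := ‹Nonempty 𝔛›
  refine ⟨fun y => F fun t => if h : t ∈ S then y ⟨t, h⟩ else x₀, hF.comp ?_, fun x => ?_⟩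
  · refine measurable_pi_lambda _ fun t => ?_
    by_cases h : t ∈ S
    · simp only [h, dite_true]; fun_prop
    · simp only [h, dite_false]; fun_prop
  · refine hS fun t ht => ?_
    have : t ∈ S := ht
    simp [this]

variable (P₀ : Measure 𝔛) [IsProbabilityMeasure P₀]

instance : IsProbabilityMeasure (lawH0 P₀) := by
  unfold lawH0; infer_instance

lemma measurePreserving_shift (a : ℕ) :
    MeasurePreserving (shift a) (lawH0 P₀) (lawH0 P₀) where
  measurable := measurable_shift a
  map_eq := Measure.map_infinitePi_infinitePi_of_inj (P := fun _ : ℕ => P₀)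
    (f := fun t : ℕ => a + t) (add_right_injective a)

lemma measurePreserving_chain (m j : ℕ) :
    MeasurePreserving (chain m j) (lawH0 P₀) (Measure.pi fun _ => P₀) where
  measurable := measurable_chain m j
  map_eq := by
    rw [← Measure.infinitePi_eq_pi]
    exact Measure.map_infinitePi_infinitePi_of_inj (P := fun _ : ℕ => P₀)
      (f := fun i : Fin m => j + (i : ℕ)) fun i k h => Fin.ext (by simpa using h)

lemma iIndepFun_coordinates : iIndepFun (fun (i : ℕ) (x : ℕ → 𝔛) => x i) (lawH0 P₀) :=
  iIndepFun_infinitePi (X := fun _ => id) (fun _ => measurable_id)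

lemma indepFun_of_dependsOn {E E' : Type*} [MeasurableSpace E] [MeasurableSpace E']
    {F : (ℕ → 𝔛) → E} {G : (ℕ → 𝔛) → E'} (hF : Measurable F) (hG : Measurable G)
    {S T : Finset ℕ} (hS : DependsOn F S) (hT : DependsOn G T) (hST : Disjoint S T) :
    IndepFun F G (lawH0 P₀) := by
  have : Nonempty 𝔛 := nonempty_of_isProbabilityMeasure P₀
  obtain ⟨f, hf, hFf⟩ := hS.exists_measurable_comp hF
  obtain ⟨g, hg, hGg⟩ := hT.exists_measurable_comp hG
  have h := ((iIndepFun_coordinates P₀).indepFun_finset S T hST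
    (fun i => measurable_pi_apply i)).comp hf hg
  convert! h using 1
  · ext x; simp [hFf]
  · ext x; simp [hGg]

lemma iIndepFun_of_dependsOn {ι : Type*} {E : ι → Type*} [∀ k, MeasurableSpace (E k)]
    {F : ∀ k, (ℕ → 𝔛) → E k} (hF : ∀ k, Measurable (F k)) {S : ι → Finset ℕ}
    (hS : ∀ k, DependsOn (F k) (S k)) (hdisj : Pairwise fun k l => Disjoint (S k) (S l)) :
    iIndepFun F (lawH0 P₀) := by
  have : Nonempty 𝔛 := nonempty_of_isProbabilityMeasure P₀
  choose G hG hFG using fun k => (hS k).exists_measurable_comp (hF k)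
  have h := (iIndepFun_coordinates P₀).comp_finsets (fun i => (measurable_pi_apply i).aemeasurable)
    hdisj hG
  convert! h using 1
  ext k x
  exact hFG k x

end Sequence

/-! ### Second moments -/

section SecondMoments

variable {Ω : Type*} [MeasurableSpace Ω] {μ : Measure Ω}

lemma integral_add_sq_le {A B : Ω → ℝ} (hA : MemLp A 2 μ) (hB : MemLp B 2 μ) :
    ∫ x, (A x + B x) ^ 2 ∂μ ≤ 2 * ∫ x, A x ^ 2 ∂μ + 2 * ∫ x, B x ^ 2 ∂μ := by
  rw [← integral_const_mul, ← integral_const_mul,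
    ← integral_add (hA.integrable_sq.const_mul 2) (hB.integrable_sq.const_mul 2)]
  refine integral_mono (hA.add hB).integrable_sq
    ((hA.integrable_sq.const_mul 2).add (hB.integrable_sq.const_mul 2)) fun x => ?_
  nlinarith [sq_nonneg (A x - B x)]

lemma integral_sq_sum_le {ι : Type*} (I : Finset ι) {A : ι → Ω → ℝ}
    (hA : ∀ i ∈ I, MemLp (A i) 2 μ) :
    ∫ x, (∑ i ∈ I, A i x) ^ 2 ∂μ ≤ I.card * ∑ i ∈ I, ∫ x, A i x ^ 2 ∂μ := by
  rw [← integral_finsetSum _ fun i hi => (hA i hi).integrable_sq, ← integral_const_mul]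
  refine integral_mono (memLp_finsetSum I hA).integrable_sq
    ((integrable_finsetSum _ fun i hi => (hA i hi).integrable_sq).const_mul _) fun x => ?_
  exact sq_sum_le_card_mul_sum_sq

/-- The mean absolute value is at most the root of the second moment. -/
lemma integral_abs_le_sqrt [IsProbabilityMeasure μ] {A : Ω → ℝ} (hA : MemLp A 2 μ) :
    ∫ x, |A x| ∂μ ≤ √(∫ x, A x ^ 2 ∂μ) := by
  have h := variance_nonneg (fun x => |A x|) μ
  have hA' : MemLp (fun x => |A x|) 2 μ := hA.norm
  rw [variance_eq_sub hA'] at h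
  refine Real.le_sqrt_of_sq_le ?_
  simpa using h

end SecondMoments

section LocalFunctions

variable {𝔛 : Type*} [MeasurableSpace 𝔛] (P₀ : Measure 𝔛) [IsProbabilityMeasure P₀]

/-- A square integrable centered function of the first `s` elements of the sequence. The shifts
`g (shift (h * i) x)` of such a function form a stationary sequence with finite memory. -/
structure IsCenteredLocal (g : (ℕ → 𝔛) → ℝ) (s : ℕ) : Prop where
  measurable : Measurable g
  dependsOn : DependsOn g (Set.Iio s)
  memLp : MemLp g 2 (lawH0 P₀)
  integral_eq_zero : ∫ x, g x ∂(lawH0 P₀) = 0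

/-- The sum of the first `M` terms of the sequence of the shifts of `g` by multiples of `h`. -/
def shiftSum (g : (ℕ → 𝔛) → ℝ) (h M : ℕ) (x : ℕ → 𝔛) : ℝ :=
  ∑ i ∈ Finset.range M, g (shift (h * i) x)

/-- The covariance of two terms, `r` steps apart, of the sequence of the shifts by multiples of `h`
of a centered function `g`. -/
noncomputable def lagCov (g : (ℕ → 𝔛) → ℝ) (h r : ℕ) : ℝ :=
  ∫ x, g x * g (shift (h * r) x) ∂(lawH0 P₀)

/-- The long-run variance of the sequence of the shifts by multiples of `h` of a centered function
`g`, when terms more than `q` steps apart are independent. -/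
noncomputable def longRunVar (g : (ℕ → 𝔛) → ℝ) (h q : ℕ) : ℝ :=
  lagCov P₀ g h 0 + 2 * ∑ r ∈ Finset.Icc 1 q, lagCov P₀ g h r

variable {P₀} {g : (ℕ → 𝔛) → ℝ} {s h q : ℕ}

lemma memLp_comp_shift {E : Type*} [NormedAddCommGroup E] {p : ENNReal} {F : (ℕ → 𝔛) → E}
    (hF : MemLp F p (lawH0 P₀)) (a : ℕ) :
    MemLp (fun x => F (shift a x)) p (lawH0 P₀) :=
  hF.comp_measurePreserving (measurePreserving_shift P₀ a)

lemma integral_comp_shift {E : Type*} [NormedAddCommGroup E] [NormedSpace ℝ E]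
    {F : (ℕ → 𝔛) → E} (hF : AEStronglyMeasurable F (lawH0 P₀)) (a : ℕ) :
    ∫ x, F (shift a x) ∂(lawH0 P₀) = ∫ x, F x ∂(lawH0 P₀) := by
  have h := (measurePreserving_shift P₀ a).map_eq
  rw [← integral_map (φ := shift a) (measurable_shift a).aemeasurable (by rwa [h]), h]

namespace IsCenteredLocal

lemma memLp_shift (hg : IsCenteredLocal P₀ g s) (a : ℕ) :
    MemLp (fun x => g (shift a x)) 2 (lawH0 P₀) :=
  memLp_comp_shift hg.memLp a

lemma comp_shift (hg : IsCenteredLocal P₀ g s) (a : ℕ) :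
    IsCenteredLocal P₀ (fun x => g (shift a x)) (a + s) where
  measurable := hg.measurable.comp (measurable_shift a)
  dependsOn := (hg.dependsOn.comp_shift a).mono fun t ht => by
    simp only [Finset.coe_Ico, Set.mem_Ico, Set.mem_Iio] at ht ⊢; omega
  memLp := hg.memLp_shift a
  integral_eq_zero := by
    rw [integral_comp_shift hg.memLp.1 a, hg.integral_eq_zero]

lemma mono (hg : IsCenteredLocal P₀ g s) {s' : ℕ} (hs : s ≤ s') : IsCenteredLocal P₀ g s' where
  __ := hg
  dependsOn := hg.dependsOn.mono (Set.Iio_subset_Iio hs)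

lemma sum_shift (hg : IsCenteredLocal P₀ g s) (h M : ℕ) {s' : ℕ}
    (hs' : ∀ i < M, h * i + s ≤ s') : IsCenteredLocal P₀ (shiftSum g h M) s' where
  measurable := Finset.measurable_fun_sum _ fun i _ => hg.measurable.comp (measurable_shift _)
  dependsOn := dependsOn_finset_sum _ fun i hi =>
    ((hg.comp_shift (h * i)).mono (hs' i (Finset.mem_range.1 hi))).dependsOn
  memLp := memLp_finsetSum _ fun i _ => hg.memLp_shift _
  integral_eq_zero := by
    unfold shiftSum
    rw [integral_finsetSum _ fun i _ => (hg.memLp_shift _).integrable (by norm_num)]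
    exact Finset.sum_eq_zero fun _ _ => (hg.comp_shift _).integral_eq_zero

lemma memLp_shiftSum (hg : IsCenteredLocal P₀ g s) (h M : ℕ) :
    MemLp (shiftSum g h M) 2 (lawH0 P₀) :=
  memLp_finsetSum _ fun _ _ => hg.memLp_shift _

lemma integral_sq_shift (hg : IsCenteredLocal P₀ g s) (h a : ℕ) :
    ∫ x, g (shift a x) ^ 2 ∂(lawH0 P₀) = lagCov P₀ g h 0 := by
  rw [integral_comp_shift (F := fun x => g x ^ 2) (hg.measurable.pow_const 2).aestronglyMeasurable]
  simp [lagCov, sq]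

lemma lagCov_zero_nonneg (g : (ℕ → 𝔛) → ℝ) (h : ℕ) : 0 ≤ lagCov P₀ g h 0 := by
  refine integral_nonneg fun x => ?_
  simpa using mul_self_nonneg (g x)

lemma integral_mul_shift (hg : IsCenteredLocal P₀ g s) (h i r : ℕ) :
    ∫ x, g (shift (h * i) x) * g (shift (h * (i + r)) x) ∂(lawH0 P₀) = lagCov P₀ g h r := by
  have hm : Measurable fun x => g x * g (shift (h * r) x) :=
    hg.measurable.mul (hg.measurable.comp (measurable_shift _))
  rw [lagCov, ← integral_comp_shift hm.aestronglyMeasurable (h * i)]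
  simp [shift_shift, mul_add]

lemma lagCov_eq_zero (hg : IsCenteredLocal P₀ g s) {r : ℕ} (hr : s ≤ h * r) :
    lagCov P₀ g h r = 0 := by
  have hS : DependsOn g (Finset.Ico 0 s : Finset ℕ) :=
    hg.dependsOn.mono fun t ht => by simpa using ht
  have hT := hg.dependsOn.comp_shift (h * r)
  have hind := indepFun_of_dependsOn P₀ hg.measurable (hg.comp_shift (h * r)).measurable hS hT
    (Finset.disjoint_left.2 fun t ht ht' => by
      simp only [Finset.mem_Ico] at ht ht'; omega)
  rw [lagCov, hind.integral_fun_mul_eq_mul_integral hg.measurable.aestronglyMeasurable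
    (hg.comp_shift (h * r)).measurable.aestronglyMeasurable, hg.integral_eq_zero, zero_mul]

lemma abs_lagCov_le (hg : IsCenteredLocal P₀ g s) (h r : ℕ) :
    |lagCov P₀ g h r| ≤ lagCov P₀ g h 0 := by
  have h1 := hg.memLp.integrable_sq
  have h2 := (hg.memLp_shift (h * r)).integrable_sq
  have e1 : ∫ x, g x ^ 2 ∂(lawH0 P₀) = lagCov P₀ g h 0 := by
    simpa using hg.integral_sq_shift h 0
  have e2 := hg.integral_sq_shift h (h * r)
  calc |lagCov P₀ g h r| ≤ ∫ x, |g x * g (shift (h * r) x)| ∂(lawH0 P₀) :=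
        abs_integral_le_integral_abs
    _ ≤ ∫ x, (1 / 2 * g x ^ 2 + 1 / 2 * g (shift (h * r) x) ^ 2) ∂(lawH0 P₀) := by
        refine integral_mono (hg.memLp.integrable_mul (hg.memLp_shift (h * r))).abs
          ((h1.const_mul _).add (h2.const_mul _)) fun x => ?_
        rw [abs_le]
        constructor <;>
          nlinarith [sq_nonneg (g x - g (shift (h * r) x)), sq_nonneg (g x + g (shift (h * r) x))]
    _ = lagCov P₀ g h 0 := by
        rw [integral_add (h1.const_mul _) (h2.const_mul _), integral_const_mul,
          integral_const_mul, e1, e2]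
        ring

lemma integral_sq_shiftSum_succ (hg : IsCenteredLocal P₀ g s) (h M : ℕ) :
    ∫ x, shiftSum g h (M + 1) x ^ 2 ∂(lawH0 P₀) =
      ∫ x, shiftSum g h M x ^ 2 ∂(lawH0 P₀) +
        (lagCov P₀ g h 0 + 2 * ∑ r ∈ Finset.Icc 1 M, lagCov P₀ g h r) := by
  have hM := hg.memLp_shiftSum h M
  have hs := hg.memLp_shift (h * M)
  have hcross : ∫ x, shiftSum g h M x * g (shift (h * M) x) ∂(lawH0 P₀) =
      ∑ r ∈ Finset.Icc 1 M, lagCov P₀ g h r := by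
    simp_rw [shiftSum, Finset.sum_mul]
    have hint : ∀ i ∈ Finset.range M, Integrable
        (fun x => g (shift (h * i) x) * g (shift (h * M) x)) (lawH0 P₀) :=
      fun i _ => (hg.memLp_shift _).integrable_mul hs
    rw [integral_finsetSum _ hint, ← Finset.sum_range_reflect]
    have : Finset.Icc 1 M = Finset.Ico (0 + 1) (M + 1) := by ext; simp
    rw [this, ← Finset.sum_Ico_add', Finset.range_eq_Ico]
    refine Finset.sum_congr rfl fun r hr => ?_
    have hr' : r < M := by simpa using hr
    rw [← hg.integral_mul_shift h (M - 1 - r) (r + 1)]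
    have e : M - 1 - r + (r + 1) = M := by omega
    rw [e]
  have e : ∀ x, shiftSum g h (M + 1) x ^ 2 = shiftSum g h M x ^ 2 +
      (g (shift (h * M) x) ^ 2 + 2 * (shiftSum g h M x * g (shift (h * M) x))) := by
    intro x
    rw [shiftSum, Finset.sum_range_succ]
    change (shiftSum g h M x + _) ^ 2 = _
    ring
  have hint : Integrable (fun x => 2 * (shiftSum g h M x * g (shift (h * M) x)))
      (lawH0 P₀) := (hM.integrable_mul hs).const_mul 2
  simp_rw [e]
  have hint' : Integrable (fun x => g (shift (h * M) x) ^ 2 +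
      2 * (shiftSum g h M x * g (shift (h * M) x))) (lawH0 P₀) := hs.integrable_sq.add hint
  rw [integral_add hM.integrable_sq hint', integral_add hs.integrable_sq hint,
    integral_const_mul, hcross, hg.integral_sq_shift h]

lemma abs_sum_lagCov_le (hg : IsCenteredLocal P₀ g s) (hq : s ≤ h * (q + 1)) (M : ℕ) :
    |∑ r ∈ Finset.Icc 1 M, lagCov P₀ g h r| ≤ q * lagCov P₀ g h 0 := by
  have hsub : ∑ r ∈ Finset.Icc 1 M, lagCov P₀ g h r =
      ∑ r ∈ Finset.Icc 1 M ∩ Finset.Icc 1 q, lagCov P₀ g h r := by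
    refine (Finset.sum_subset Finset.inter_subset_left fun r hr hr' => ?_).symm
    refine hg.lagCov_eq_zero (hq.trans (Nat.mul_le_mul_left h ?_))
    simp only [Finset.mem_inter, Finset.mem_Icc] at hr hr'
    omega
  rw [hsub]
  refine (Finset.abs_sum_le_sum_abs _ _).trans ((Finset.sum_le_card_nsmul _ _ _
    fun r _ => hg.abs_lagCov_le h r).trans ?_)
  rw [nsmul_eq_mul]
  refine mul_le_mul_of_nonneg_right ?_ (lagCov_zero_nonneg g h)
  exact_mod_cast (Finset.card_le_card Finset.inter_subset_right).trans (by simp)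

/-- Finite memory makes the second moment of a sum grow at most linearly. -/
lemma integral_sq_shiftSum_le (hg : IsCenteredLocal P₀ g s) (hq : s ≤ h * (q + 1)) (M : ℕ) :
    ∫ x, shiftSum g h M x ^ 2 ∂(lawH0 P₀) ≤ M * ((1 + 2 * q) * lagCov P₀ g h 0) := by
  induction M with
  | zero => simp [shiftSum]
  | succ M ih =>
    rw [hg.integral_sq_shiftSum_succ]
    have := (abs_le.1 (hg.abs_sum_lagCov_le hq M)).2
    push_cast
    linarith

/-- From the `q`-th term on, every further term adds the long-run variance to the second moment of
the sum. -/
lemma integral_sq_shiftSum_add (hg : IsCenteredLocal P₀ g s) (hq : s ≤ h * (q + 1)) (m : ℕ) :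
    ∫ x, shiftSum g h (q + m) x ^ 2 ∂(lawH0 P₀) =
      ∫ x, shiftSum g h q x ^ 2 ∂(lawH0 P₀) + m * longRunVar P₀ g h q := by
  induction m with
  | zero => simp
  | succ m ih =>
    have hsum : ∑ r ∈ Finset.Icc 1 (q + m), lagCov P₀ g h r =
        ∑ r ∈ Finset.Icc 1 q, lagCov P₀ g h r := by
      refine (Finset.sum_subset (Finset.Icc_subset_Icc_right (by omega)) fun r hr hr' => ?_).symm
      refine hg.lagCov_eq_zero (hq.trans (Nat.mul_le_mul_left h ?_))
      simp only [Finset.mem_Icc] at hr hr'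
      omega
    rw [← add_assoc, hg.integral_sq_shiftSum_succ, ih, hsum, longRunVar]
    push_cast
    ring

lemma tendsto_integral_sq_shiftSum_div (hg : IsCenteredLocal P₀ g s) (hq : s ≤ h * (q + 1)) :
    Tendsto (fun m : ℕ => (∫ x, shiftSum g h m x ^ 2 ∂(lawH0 P₀)) / ((q + m : ℕ) : ℝ))
      atTop (𝓝 (longRunVar P₀ g h q)) := by
  set σ := longRunVar P₀ g h q
  set c := ∫ x, shiftSum g h q x ^ 2 ∂(lawH0 P₀)
  have h1 : Tendsto (fun m : ℕ => (c - 2 * q * σ) * (((q + m : ℕ) : ℝ))⁻¹ + σ) atTop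
      (𝓝 ((c - 2 * q * σ) * 0 + σ)) := by
    refine Tendsto.add_const _ (Tendsto.const_mul _ ?_)
    refine tendsto_inv_atTop_zero.comp (tendsto_natCast_atTop_atTop.comp ?_)
    exact tendsto_atTop_mono (fun m => Nat.le_add_left m q) tendsto_id
  rw [mul_zero, zero_add] at h1
  refine h1.congr' ?_
  filter_upwards [eventually_ge_atTop (q + 1)] with m hm
  obtain ⟨k, rfl⟩ := Nat.exists_eq_add_of_le (show q ≤ m by omega)
  rw [hg.integral_sq_shiftSum_add hq k]
  have : ((q + (q + k) : ℕ) : ℝ) ≠ 0 := by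
    have : q + (q + k) ≠ 0 := by omega
    exact_mod_cast this
  field_simp
  push_cast
  simp only [c, σ]
  ring

lemma longRunVar_nonneg (hg : IsCenteredLocal P₀ g s) (hq : s ≤ h * (q + 1)) :
    0 ≤ longRunVar P₀ g h q :=
  ge_of_tendsto' (hg.tendsto_integral_sq_shiftSum_div hq) fun _ =>
    div_nonneg (integral_nonneg fun _ => sq_nonneg _) (Nat.cast_nonneg _)

end IsCenteredLocal

end LocalFunctions

/-! ### The central limit theorem for local functions -/

section MeanExp

variable {Ω : Type*} [MeasurableSpace Ω] {μ : Measure Ω}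

/-- The value at `1` of the characteristic function of the law of `A`. -/
noncomputable def meanExp (μ : Measure Ω) (A : Ω → ℝ) : ℂ :=
  ∫ x, Complex.exp (A x * Complex.I) ∂μ

lemma norm_exp_mul_I_sub_le (a b : ℝ) :
    ‖Complex.exp (a * Complex.I) - Complex.exp (b * Complex.I)‖ ≤ |a - b| := by
  have e : Complex.exp (a * Complex.I) - Complex.exp (b * Complex.I) =
      Complex.exp (b * Complex.I) * (Complex.exp (Complex.I * ((a - b : ℝ) : ℂ)) - 1) := by
    rw [mul_sub, ← Complex.exp_add, mul_one]
    congr 2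
    push_cast
    ring
  rw [e, norm_mul, Complex.norm_exp_ofReal_mul_I, one_mul]
  exact Real.norm_exp_I_mul_ofReal_sub_one_le

lemma integrable_exp_mul_I [IsFiniteMeasure μ] {A : Ω → ℝ} (hA : AEStronglyMeasurable A μ) :
    Integrable (fun x => Complex.exp (A x * Complex.I)) μ := by
  refine Integrable.of_bound (C := 1) ?_ (ae_of_all _ fun x => ?_)
  · have hc : Continuous fun r : ℝ => Complex.exp (r * Complex.I) := by fun_prop
    exact hc.comp_aestronglyMeasurable hA
  · rw [Complex.norm_exp_ofReal_mul_I]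

/-- Characteristic functions are close when the variables are close in mean square. -/
lemma norm_meanExp_sub_le [IsProbabilityMeasure μ] {A B : Ω → ℝ} (hA : MemLp A 2 μ)
    (hB : MemLp B 2 μ) :
    ‖meanExp μ A - meanExp μ B‖ ≤ √(∫ x, (A x - B x) ^ 2 ∂μ) := by
  have hAB : MemLp (fun x => A x - B x) 2 μ := hA.sub hB
  refine le_trans ?_ (integral_abs_le_sqrt hAB)
  rw [meanExp, meanExp, ← integral_sub (integrable_exp_mul_I hA.1) (integrable_exp_mul_I hB.1)]
  exact norm_integral_le_of_norm_le (hAB.integrable (by norm_num)).abs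
    (ae_of_all _ fun x => norm_exp_mul_I_sub_le _ _)

end MeanExp

/-- Convergence of a sequence approximated, uniformly up to a vanishing error, by convergent
sequences. -/
lemma tendsto_of_tendsto_of_norm_sub_le {f : ℕ → ℂ} {φ : ℕ → ℕ → ℂ} {ψ : ℕ → ℂ} {L : ℂ}
    {b : ℕ → ℕ → ℝ} {β : ℕ → ℝ} (hφ : ∀ᶠ m in atTop, Tendsto (φ m) atTop (𝓝 (ψ m)))
    (hψ : Tendsto ψ atTop (𝓝 L)) (hf : ∀ᶠ m in atTop, ∀ᶠ n in atTop, ‖f n - φ m n‖ ≤ b m n)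
    (hb : ∀ᶠ m in atTop, Tendsto (b m) atTop (𝓝 (β m))) (hβ : Tendsto β atTop (𝓝 0)) :
    Tendsto f atTop (𝓝 L) := by
  rw [Metric.tendsto_nhds]
  intro δ hδ
  have h1 := (Metric.tendsto_nhds.1 hψ) (δ / 3) (by positivity)
  have h2 := hβ.eventually_lt_const (show (0 : ℝ) < δ / 3 by positivity)
  obtain ⟨m, hφm, hfm, hbm, h1m, h2m⟩ := (hφ.and (hf.and (hb.and (h1.and h2)))).exists
  have h3 := hbm.eventually_lt_const h2m
  have h4 := (Metric.tendsto_nhds.1 hφm) (δ / 3) (by positivity)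
  filter_upwards [hfm, h3, h4] with n hn h3n h4n
  rw [← dist_eq_norm] at hn
  calc dist (f n) L ≤ dist (f n) (φ m n) + dist (φ m n) (ψ m) + dist (ψ m) L :=
        dist_triangle4 _ _ _ _
    _ < δ := by linarith

lemma tendsto_div_of_abs_sub_le {a : ℕ → ℝ} {c C : ℝ}
    (h : ∀ᶠ n : ℕ in atTop, |a n - c * n| ≤ C) :
    Tendsto (fun n : ℕ => a n / n) atTop (𝓝 c) := by
  rw [tendsto_iff_norm_sub_tendsto_zero]
  refine squeeze_zero' (Eventually.of_forall fun _ => norm_nonneg _) ?_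
    (tendsto_const_div_atTop_nhds_zero_nat C)
  filter_upwards [h, eventually_gt_atTop 0] with n hn hpos
  have hn0 : (0 : ℝ) < n := by exact_mod_cast hpos
  rw [Real.norm_eq_abs, le_div_iff₀ hn0, ← abs_of_pos hn0, ← abs_mul, abs_of_pos hn0, sub_mul,
    div_mul_cancel₀ _ hn0.ne']
  exact hn

lemma abs_natDiv_sub_le {K : ℕ} (hK : 0 < K) (n : ℕ) :
    |((n / K : ℕ) : ℝ) - (K : ℝ)⁻¹ * n| ≤ 1 := by
  have hK' : (0 : ℝ) < K := by exact_mod_cast hK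
  have h := Nat.div_add_mod n K
  have hlt := Nat.mod_lt n hK
  have h' : (K : ℝ) * (n / K : ℕ) + (n % K : ℕ) = n := by exact_mod_cast h
  have hlt' : ((n % K : ℕ) : ℝ) ≤ K := by exact_mod_cast hlt.le
  have h0 : (0 : ℝ) ≤ (n % K : ℕ) := Nat.cast_nonneg _
  have e : ((n / K : ℕ) : ℝ) - (K : ℝ)⁻¹ * n = -((n % K : ℕ) / K) := by
    rw [← h']; field_simp; ring
  rw [e, abs_neg, abs_of_nonneg (by positivity), div_le_one hK']
  exact hlt'

section CentralLimit

section Algebra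

variable {𝔛 : Type*}

lemma shiftSum_add (g : (ℕ → 𝔛) → ℝ) (h M K : ℕ) (x : ℕ → 𝔛) :
    shiftSum g h (M + K) x = shiftSum g h M x + shiftSum g h K (shift (h * M) x) := by
  simp [shiftSum, Finset.sum_range_add, shift_shift, mul_add]

lemma shiftSum_mul (g : (ℕ → 𝔛) → ℝ) (h K J : ℕ) (x : ℕ → 𝔛) :
    shiftSum g h (K * J) x = shiftSum (shiftSum g h K) (h * K) J x := by
  induction J with
  | zero => simp [shiftSum]
  | succ J ih =>
    rw [mul_add, mul_one, shiftSum_add, ih, shiftSum, shiftSum, shiftSum, Finset.sum_range_succ,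
      mul_assoc]
    rfl

lemma shiftSum_fun_add (g₁ g₂ : (ℕ → 𝔛) → ℝ) (h M : ℕ) (x : ℕ → 𝔛) :
    shiftSum (fun y => g₁ y + g₂ y) h M x = shiftSum g₁ h M x + shiftSum g₂ h M x :=
  Finset.sum_add_distrib

end Algebra

variable {𝔛 : Type*} [MeasurableSpace 𝔛] {P₀ : Measure 𝔛} [IsProbabilityMeasure P₀]
  {g : (ℕ → 𝔛) → ℝ} {s h q : ℕ}

namespace IsCenteredLocal

/-- The central limit theorem for the shifts of a local function by steps so long that these
shifts are independent. -/
lemma tendsto_meanExp_of_le (hg : IsCenteredLocal P₀ g s) (hs : s ≤ h) (t : ℝ) :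
    Tendsto (fun J : ℕ => meanExp (lawH0 P₀) fun x => t * ((√J)⁻¹ * shiftSum g h J x)) atTop
      (𝓝 (Complex.exp ((-(t ^ 2 * ∫ x, g x ^ 2 ∂(lawH0 P₀)) / 2 : ℝ) : ℂ))) := by
  set ξ : ℕ → (ℕ → 𝔛) → ℝ := fun i x => g (shift (h * i) x) with hξ
  have hm : ∀ i, Measurable (ξ i) := fun i => hg.measurable.comp (measurable_shift _)
  have hindep : iIndepFun ξ (lawH0 P₀) := by
    refine iIndepFun_of_dependsOn P₀ hm (fun i => hg.dependsOn.comp_shift (h * i)) ?_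
    intro i j hij
    wlog hlt : i < j generalizing i j
    · exact (this hij.symm (by omega)).symm
    have : h * (i + 1) ≤ h * j := Nat.mul_le_mul_left h hlt
    rw [mul_add] at this
    exact Finset.disjoint_left.2 fun a ha ha' => by
      simp only [Finset.mem_Ico] at ha ha'; omega
  have hξ0 : ξ 0 = g := by ext x; simp [hξ]
  have hident : ∀ i, IdentDistrib (ξ i) (ξ 0) (lawH0 P₀) (lawH0 P₀) := fun i =>
    ⟨(hm i).aemeasurable, (hm 0).aemeasurable, by
      rw [hξ0, show ξ i = g ∘ shift (h * i) from rfl, ← Measure.map_map hg.measurable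
        (measurable_shift _), (measurePreserving_shift P₀ _).map_eq]⟩
  have hvar : Var[ξ 0; lawH0 P₀] = ∫ x, g x ^ 2 ∂(lawH0 P₀) := by
    rw [hξ0, variance_of_integral_eq_zero hg.measurable.aemeasurable hg.integral_eq_zero]
  have hnonneg : 0 ≤ ∫ x, g x ^ 2 ∂(lawH0 P₀) := integral_nonneg fun _ => sq_nonneg _
  have hclt := tendstoInDistribution_inv_sqrt_mul_sum_sub (P := lawH0 P₀) (X := ξ)
    (Y := id) (P' := gaussianReal 0 Var[ξ 0; lawH0 P₀].toNNReal) HasLaw.id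
    (by rw [hξ0]; exact hg.memLp) hindep hident
  have hlim := ProbabilityMeasure.tendsto_iff_tendsto_charFun.1 hclt.tendsto t
  simp only [ProbabilityMeasure.coe_mk, Measure.map_id, charFun_gaussianReal] at hlim
  convert! hlim using 1
  · ext J
    rw [charFun_apply_real, integral_map (by fun_prop) (by fun_prop), meanExp]
    refine integral_congr_ae (ae_of_all _ fun x => ?_)
    simp [hg.integral_eq_zero, shiftSum, hξ]
  · rw [hvar]
    congr 2
    rw [← Complex.ofReal_pow]
    have : (((∫ x, g x ^ 2 ∂(lawH0 P₀)).toNNReal : ℝ) : ℂ) =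
        ((∫ x, g x ^ 2 ∂(lawH0 P₀) : ℝ) : ℂ) := by rw [Real.coe_toNNReal _ hnonneg]
    change _ = _ - (((∫ x, g x ^ 2 ∂(lawH0 P₀)).toNNReal : ℝ) : ℂ) * _ / 2
    rw [this]
    push_cast
    ring

/-- The sum of `M` terms of the sequence differs little in mean square from the sum over the
complete blocks of `q + m` terms, each of them deprived of its last `q` terms. -/
lemma integral_sq_shiftSum_sub_le (hg : IsCenteredLocal P₀ g s) (hq : s ≤ h * (q + 1)) {m : ℕ}
    (hm : 0 < m) (M : ℕ) :
    ∫ x, (shiftSum g h M x -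
        shiftSum (shiftSum g h m) (h * (q + m)) (M / (q + m)) x) ^ 2 ∂(lawH0 P₀) ≤
      2 * ((M / (q + m) : ℕ) * (3 * ∫ x, shiftSum g h q x ^ 2 ∂(lawH0 P₀))) +
        2 * ((q + m : ℕ) * ((1 + 2 * q) * lagCov P₀ g h 0)) := by
  set K := q + m with hK
  set J := M / K
  set V : (ℕ → 𝔛) → ℝ := fun x => shiftSum g h q (shift (h * m) x)
  have hKpos : 0 < K := by omega
  have hV : IsCenteredLocal P₀ V (h * m + (h * q + s)) :=
    (hg.sum_shift h q (s' := h * q + s) fun i hi => by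
      have := Nat.mul_le_mul_left h hi.le; omega).comp_shift (h * m)
  have hsK : s ≤ h * K := hq.trans (Nat.mul_le_mul_left h (by omega))
  have hVspan : h * m + (h * q + s) ≤ h * K * (1 + 1) := by
    have : h * K = h * q + h * m := by rw [hK, mul_add]
    omega
  have hrem := hg.integral_sq_shiftSum_le hq (M % K)
  have hdec : ∀ x, shiftSum g h M x - shiftSum (shiftSum g h m) (h * K) J x =
      shiftSum V (h * K) J x + shiftSum g h (M % K) (shift (h * (K * J)) x) := by
    intro x
    have e : shiftSum g h K = fun y => shiftSum g h m y + V y := by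
      ext y; rw [hK, add_comm q m, shiftSum_add]
    conv_lhs => rw [← Nat.div_add_mod M K]
    rw [shiftSum_add, shiftSum_mul, e, shiftSum_fun_add]
    ring
  simp_rw [hdec]
  refine (integral_add_sq_le (hV.memLp_shiftSum _ _)
    (memLp_comp_shift (hg.memLp_shiftSum h (M % K)) _)).trans ?_
  have h1 := hV.integral_sq_shiftSum_le (h := h * K) (q := 1) hVspan J
  have h2 : lagCov P₀ V (h * K) 0 = ∫ x, shiftSum g h q x ^ 2 ∂(lawH0 P₀) := by
    rw [← hV.integral_sq_shift (h * K) 0]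
    simp only [shift_zero, V]
    exact integral_comp_shift (F := fun x => shiftSum g h q x ^ 2)
      ((hg.memLp_shiftSum h q).1.pow 2) _
  have h3 : ∫ x, shiftSum g h (M % K) (shift (h * (K * J)) x) ^ 2 ∂(lawH0 P₀) =
      ∫ x, shiftSum g h (M % K) x ^ 2 ∂(lawH0 P₀) :=
    integral_comp_shift (F := fun x => shiftSum g h (M % K) x ^ 2)
      ((hg.memLp_shiftSum h _).1.pow 2) _
  have h4 : ((M % K : ℕ) : ℝ) * ((1 + 2 * q) * lagCov P₀ g h 0) ≤
      K * ((1 + 2 * q) * lagCov P₀ g h 0) := by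
    refine mul_le_mul_of_nonneg_right (by exact_mod_cast (Nat.mod_lt M hKpos).le) ?_
    have := lagCov_zero_nonneg (P₀ := P₀) g h
    positivity
  rw [h2] at h1
  rw [h3]
  norm_num at h1
  linarith

/-- The central limit theorem for the shifts of a local function. Blocks of `m` terms separated by
gaps of `q` terms are independent, and the gaps contribute little when `m` is large. -/
theorem tendsto_meanExp (hg : IsCenteredLocal P₀ g s) (hq : s ≤ h * (q + 1)) (t : ℝ) :
    Tendsto (fun M : ℕ => meanExp (lawH0 P₀) fun x => t * ((√M)⁻¹ * shiftSum g h M x)) atTop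
      (𝓝 (Complex.exp ((-(t ^ 2 * longRunVar P₀ g h q) / 2 : ℝ) : ℂ))) := by
  set D := ∫ x, shiftSum g h q x ^ 2 ∂(lawH0 P₀)
  set C := (1 + 2 * q) * lagCov P₀ g h 0
  set u : ℕ → ℝ := fun m => ∫ x, shiftSum g h m x ^ 2 ∂(lawH0 P₀)
  set K : ℕ → ℕ := fun m => q + m with hKdef
  have hK : ∀ m, K m = q + m := fun _ => rfl
  have hKtop : Tendsto (fun m => ((K m : ℕ) : ℝ)) atTop atTop :=
    tendsto_natCast_atTop_atTop.comp
      (tendsto_atTop_mono (fun m => Nat.le_add_left m q) tendsto_id)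
  have hU : ∀ m, IsCenteredLocal P₀ (shiftSum g h m) (h * K m) := fun m =>
    hg.sum_shift h m fun i hi => by
      have h1 := Nat.mul_le_mul_left h (show i + (q + 1) ≤ K m by rw [hK]; omega)
      rw [mul_add] at h1
      omega
  refine tendsto_of_tendsto_of_norm_sub_le
    (φ := fun m M => meanExp (lawH0 P₀) fun x => (t * (√(K m))⁻¹) *
      ((√(M / K m : ℕ))⁻¹ * shiftSum (shiftSum g h m) (h * K m) (M / K m) x))
    (ψ := fun m => Complex.exp ((-((t * (√(K m))⁻¹) ^ 2 * u m) / 2 : ℝ) : ℂ))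
    (b := fun m M => √(2 * (t ^ 2 * (2 * (((M / K m : ℕ) : ℝ) / M * (3 * D)) +
      2 * (K m * C) / M)) + 2 * (t ^ 2 * ((√((M / K m : ℕ) / M) - (√(K m))⁻¹) ^ 2 * u m))))
    (β := fun m => √(2 * (t ^ 2 * (2 * ((K m : ℝ)⁻¹ * (3 * D)) + 0)) +
      2 * (t ^ 2 * ((√((K m : ℝ)⁻¹) - (√(K m))⁻¹) ^ 2 * u m))))
    ?_ ?_ ?_ ?_ ?_
  · filter_upwards [eventually_gt_atTop 0] with m hm
    exact ((hU m).tendsto_meanExp_of_le le_rfl (t * (√(K m))⁻¹)).comp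
      (Nat.tendsto_div_const_atTop (show K m ≠ 0 by rw [hK]; omega))
  · have h1 := hg.tendsto_integral_sq_shiftSum_div hq
    have hc : Continuous fun r : ℝ => Complex.exp ((-(t ^ 2 * r) / 2 : ℝ) : ℂ) := by fun_prop
    refine ((hc.tendsto _).comp h1).congr fun m => ?_
    simp only [Function.comp_apply]
    congr 3
    rw [mul_pow, inv_pow, Real.sq_sqrt (Nat.cast_nonneg _)]
    simp only [u, hKdef]
    ring
  · filter_upwards [eventually_gt_atTop 0] with m hm
    filter_upwards [eventually_ge_atTop (K m)] with M hM
    have hKpos : 0 < K m := by rw [hK]; omega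
    have hMpos : (0 : ℝ) < M := by exact_mod_cast (by omega : 0 < M)
    set J := M / K m
    have hJpos : (0 : ℝ) < J := by exact_mod_cast Nat.div_pos hM hKpos
    set S := shiftSum g h M
    set U := shiftSum (shiftSum g h m) (h * K m) J
    have hS : MemLp S 2 (lawH0 P₀) := hg.memLp_shiftSum _ _
    have hUm : MemLp U 2 (lawH0 P₀) := (hU m).memLp_shiftSum _ _
    refine (norm_meanExp_sub_le ((hS.const_mul _).const_mul _)
      ((hUm.const_mul _).const_mul _)).trans (Real.sqrt_le_sqrt ?_)
    have hUsq := (hU m).integral_sq_shiftSum_le (h := h * K m) (q := 0) (by simp) J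
    have hu : lagCov P₀ (shiftSum g h m) (h * K m) 0 = u m := by
      rw [← (hU m).integral_sq_shift (h * K m) 0]; simp [u]
    rw [hu] at hUsq
    norm_num at hUsq
    have hR := hg.integral_sq_shiftSum_sub_le hq hm M
    have e : ∀ x, t * ((√M)⁻¹ * S x) - t * (√(K m))⁻¹ * ((√J)⁻¹ * U x) =
        t * (√M)⁻¹ * (S x - U x) + t * ((√(J / M) - (√(K m))⁻¹) * (√J)⁻¹) * U x := by
      intro x
      have h1 : √((J : ℝ) / M) = √J * (√M)⁻¹ := by
        rw [Real.sqrt_div (Nat.cast_nonneg _), div_eq_mul_inv]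
      have h2 : √(J : ℝ) ≠ 0 := (Real.sqrt_pos.2 hJpos).ne'
      rw [h1]
      field_simp
      ring
    simp_rw [e]
    have hSU : MemLp (fun x => S x - U x) 2 (lawH0 P₀) := hS.sub hUm
    refine (integral_add_sq_le (hSU.const_mul _) (hUm.const_mul _)).trans ?_
    simp_rw [mul_pow, integral_const_mul, inv_pow]
    rw [Real.sq_sqrt hMpos.le, Real.sq_sqrt hJpos.le]
    refine add_le_add ?_ ?_
    · rw [mul_assoc (t ^ 2)]
      refine mul_le_mul_of_nonneg_left (mul_le_mul_of_nonneg_left ?_ (sq_nonneg t)) two_pos.le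
      rw [inv_mul_le_iff₀ hMpos]
      refine hR.trans (le_of_eq ?_)
      field_simp
      simp only [D, C, J, hKdef]
      push_cast
      ring
    · rw [mul_assoc (t ^ 2), mul_assoc]
      refine mul_le_mul_of_nonneg_left (mul_le_mul_of_nonneg_left
        (mul_le_mul_of_nonneg_left ?_ (sq_nonneg _)) (sq_nonneg t)) two_pos.le
      rw [inv_mul_le_iff₀ hJpos]
      exact hUsq
  · filter_upwards [eventually_gt_atTop 0] with m hm
    have hJ : Tendsto (fun M : ℕ => ((M / K m : ℕ) : ℝ) / M) atTop (𝓝 (K m : ℝ)⁻¹) :=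
      tendsto_div_of_abs_sub_le (C := 1)
        (Eventually.of_forall fun M => abs_natDiv_sub_le (by rw [hK]; omega) M)
    have h0 := tendsto_const_div_atTop_nhds_zero_nat (2 * (K m * C))
    refine (Real.continuous_sqrt.tendsto _).comp (Tendsto.add ?_ ?_)
    · exact (((hJ.mul_const _).const_mul _).add h0).const_mul _ |>.const_mul _
    · exact (((((Real.continuous_sqrt.tendsto _).comp hJ).sub_const _).pow 2).mul_const _
        |>.const_mul _).const_mul _
  · have h1 : Tendsto (fun m => (K m : ℝ)⁻¹) atTop (𝓝 0) := tendsto_inv_atTop_zero.comp hKtop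
    have h2 : Tendsto (fun m => √(2 * (t ^ 2 * (2 * ((K m : ℝ)⁻¹ * (3 * D)) + 0)))) atTop
        (𝓝 √(2 * (t ^ 2 * (2 * (0 * (3 * D)) + 0)))) :=
      (Real.continuous_sqrt.tendsto _).comp
        ((((h1.mul_const _).const_mul _).add_const _).const_mul _ |>.const_mul _)
    simp only [zero_mul, mul_zero, add_zero, Real.sqrt_zero] at h2
    refine h2.congr fun m => ?_
    simp [Real.sqrt_inv]

lemma const_mul (hg : IsCenteredLocal P₀ g s) (c : ℝ) :
    IsCenteredLocal P₀ (fun x => c * g x) s where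
  measurable := hg.measurable.const_mul c
  dependsOn := fun _ _ hxy => congrArg (c * ·) (hg.dependsOn hxy)
  memLp := hg.memLp.const_mul c
  integral_eq_zero := by rw [integral_const_mul, hg.integral_eq_zero, mul_zero]

lemma finset_sum {ι : Type*} (I : Finset ι) {G : ι → (ℕ → 𝔛) → ℝ}
    (hG : ∀ i ∈ I, IsCenteredLocal P₀ (G i) s) :
    IsCenteredLocal P₀ (fun x => ∑ i ∈ I, G i x) s where
  measurable := Finset.measurable_fun_sum _ fun i hi => (hG i hi).measurable
  dependsOn := dependsOn_finset_sum _ fun i hi => (hG i hi).dependsOn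
  memLp := memLp_finsetSum _ fun i hi => (hG i hi).memLp
  integral_eq_zero := by
    rw [integral_finsetSum _ fun i hi => (hG i hi).memLp.integrable (by norm_num)]
    exact Finset.sum_eq_zero fun i hi => (hG i hi).integral_eq_zero

/-- The central limit theorem for sums of consecutive terms with varying numbers of terms,
starting points and normalizing factors. -/
theorem tendsto_meanExp_comp (hg : IsCenteredLocal P₀ g s) (hq : s ≤ h * (q + 1)) {M : ℕ → ℕ}
    (hM : Tendsto M atTop atTop) {c : ℕ → ℝ} {c₀ : ℝ}
    (hc : Tendsto (fun n => c n * √(M n)) atTop (𝓝 c₀)) (a : ℕ → ℕ) :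
    Tendsto (fun n => meanExp (lawH0 P₀) fun x => c n * shiftSum g h (M n) (shift (a n) x)) atTop
      (𝓝 (Complex.exp ((-(c₀ ^ 2 * longRunVar P₀ g h q) / 2 : ℝ) : ℂ))) := by
  have hS : ∀ m, MemLp (shiftSum g h m) 2 (lawH0 P₀) := hg.memLp_shiftSum h
  have hshift : ∀ n, (meanExp (lawH0 P₀) fun x => c n * shiftSum g h (M n) (shift (a n) x)) =
      meanExp (lawH0 P₀) fun x => c n * shiftSum g h (M n) x := fun n =>
    integral_comp_shift
      (F := fun x => Complex.exp (((c n * shiftSum g h (M n) x : ℝ) : ℂ) * Complex.I))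
      (integrable_exp_mul_I ((hS _).const_mul _).1).1 (a n)
  simp_rw [hshift]
  have hclt := (hg.tendsto_meanExp hq c₀).comp hM
  set C := (1 + 2 * q) * lagCov P₀ g h 0
  have hlim : Tendsto (fun n => √((c n * √(M n) - c₀) ^ 2 * C)) atTop (𝓝 0) := by
    have := (Real.continuous_sqrt.tendsto _).comp (((hc.sub_const c₀).pow 2).mul_const C)
    simpa [Function.comp_def] using this
  rw [← sub_zero (Complex.exp _)]
  have hdiff : Tendsto (fun n => (meanExp (lawH0 P₀) fun x => c₀ * ((√(M n))⁻¹ *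
      shiftSum g h (M n) x)) - meanExp (lawH0 P₀) fun x => c n * shiftSum g h (M n) x)
      atTop (𝓝 0) := by
    refine squeeze_zero_norm' ?_ hlim
    filter_upwards [hM.eventually_gt_atTop 0] with n hn
    have hn' : (0 : ℝ) < M n := by exact_mod_cast hn
    have hsq := hg.integral_sq_shiftSum_le hq (M n)
    refine (norm_meanExp_sub_le (((hS _).const_mul _).const_mul _)
      ((hS _).const_mul _)).trans (Real.sqrt_le_sqrt ?_)
    have e : ∀ x, c₀ * ((√(M n))⁻¹ * shiftSum g h (M n) x) - c n * shiftSum g h (M n) x =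
        -((c n * √(M n) - c₀) * (√(M n))⁻¹) * shiftSum g h (M n) x := by
      intro x
      have : √(M n : ℝ) ≠ 0 := (Real.sqrt_pos.2 hn').ne'
      field_simp
      ring
    simp_rw [e, mul_pow, integral_const_mul, neg_sq, mul_pow, inv_pow]
    rw [Real.sq_sqrt hn'.le, mul_assoc]
    refine mul_le_mul_of_nonneg_left ?_ (sq_nonneg _)
    rw [inv_mul_le_iff₀ hn']
    exact hsq
  refine (hclt.sub hdiff).congr fun n => ?_
  simp

end IsCenteredLocal

end CentralLimit

/-! ### The vectors `Z` -/

namespace StatParams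

lemma sum_comp_chain_eq {𝔛 : Type*} {m : ℕ} (f : (Fin m → 𝔛) → ℝ) (E : ℝ) (e M : ℕ)
    (x : ℕ → 𝔛) :
    ∑ u ∈ Finset.range M, f (chain m (e * u) x) =
      shiftSum (fun y => f (chain m 0 y) - E) e M x + M * E := by
  have h : ∀ u, f (chain m (e * u) x) = f (chain m 0 (shift (e * u) x)) := fun u => by
    rw [chain_eq_chain_shift m (e * u)]
  simp [shiftSum, h]

/-- Case distinction for the coordinates of the vectors `Z`. -/
lemma forall_index {𝔛 : Type*} {p : StatParams 𝔛} {Q : Fin (p.Ksb + 3) → Prop}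
    (hSb : ∀ j, Q (p.idxSb j)) (hLb : Q p.idxLb) (hSum : Q p.idxSum) (j : Fin (p.Ksb + 3)) :
    Q j := by
  by_cases h1 : (j : ℕ) < p.Ksb + 1
  · exact hSb ⟨j, h1⟩
  · by_cases h2 : (j : ℕ) = p.Ksb + 1
    · have : j = p.idxLb := Fin.ext h2
      rwa [this]
    · have : j = p.idxSum := Fin.ext (by simp only [idxSum]; omega)
      rwa [this]

variable {𝔛 : Type*} [MeasurableSpace 𝔛] (p : StatParams 𝔛)
  (P₀ : Measure 𝔛) [IsProbabilityMeasure P₀]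

/-- The centered summand of the summing statistic. -/
noncomputable def centeredSum (x : ℕ → 𝔛) : ℝ := p.fSum (chain p.mSum 0 x) - meanH0 P₀ p.fSum

/-- The centered summand of the sums over long blocks. -/
noncomputable def centeredLb (x : ℕ → 𝔛) : ℝ := p.fLb (chain p.mLb 0 x) - meanH0 P₀ p.fLb

/-- The centered indicator of the event counted in short blocks. -/
noncomputable def centeredSb (j : Fin (p.Ksb + 1)) (x : ℕ → 𝔛) : ℝ :=
  (p.αSb j).indicator 1 (p.fSb (chain p.Lsb 0 x)) - p.Esb P₀ j

/-- The vector function whose shifts are the centered vectors `Z`. -/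
noncomputable def centeredVec (h : ℕ) (x : ℕ → 𝔛) : EuclideanSpace ℝ (Fin (p.Ksb + 3)) :=
  p.fVec P₀ h x - p.meanZ P₀ h

variable {p P₀}

lemma isCenteredLocal_comp_chain {m : ℕ} {f : (Fin m → 𝔛) → ℝ} (hf : Measurable f)
    (hf2 : MemLp f 2 (Measure.pi fun _ => P₀)) :
    IsCenteredLocal P₀ (fun x => f (chain m 0 x) - meanH0 P₀ f) m := by
  have h2 : MemLp (fun x => f (chain m 0 x)) 2 (lawH0 P₀) :=
    hf2.comp_measurePreserving (measurePreserving_chain P₀ m 0)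
  refine ⟨(hf.comp (measurable_chain m 0)).sub_const _, fun x y hxy => ?_,
    h2.sub (memLp_const _), ?_⟩
  · simp only [dependsOn_comp_chain f hxy]
  · rw [integral_sub (h2.integrable (by norm_num)) (integrable_const _)]
    simp [meanH0]

namespace WellDefined

variable (hp : p.WellDefined P₀)
include hp

lemma isCenteredLocal_centeredSum : IsCenteredLocal P₀ (p.centeredSum P₀) p.mSum :=
  isCenteredLocal_comp_chain hp.measurable_fSum hp.memLp_fSum

lemma isCenteredLocal_centeredLb : IsCenteredLocal P₀ (p.centeredLb P₀) p.mLb :=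
  isCenteredLocal_comp_chain hp.measurable_fLb hp.memLp_fLb

lemma isCenteredLocal_centeredSb (j : Fin (p.Ksb + 1)) :
    IsCenteredLocal P₀ (p.centeredSb P₀ j) p.Lsb := by
  have e : (fun y => (p.αSb j).indicator (1 : ℝ → ℝ) (p.fSb y)) =
      (p.fSb ⁻¹' p.αSb j).indicator 1 := by
    ext y; by_cases hy : p.fSb y ∈ p.αSb j <;> simp [Set.indicator, Set.mem_preimage, hy]
  have hm : Measurable fun y => (p.αSb j).indicator (1 : ℝ → ℝ) (p.fSb y) := by
    rw [e]; exact measurable_one.indicator (hp.measurableSet_αSb j)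
  have hE : meanH0 P₀ (fun y => (p.αSb j).indicator (1 : ℝ → ℝ) (p.fSb y)) = p.Esb P₀ j := by
    have e' : (fun x => (p.αSb j).indicator (1 : ℝ → ℝ) (p.fSb (chain p.Lsb 0 x))) =
        {x | p.fSb (chain p.Lsb 0 x) ∈ p.αSb j}.indicator 1 := by
      ext x; simp [Set.indicator]
    rw [meanH0, e', integral_indicator_one]
    · rfl
    · exact (hp.measurableSet_αSb j).preimage (measurable_chain p.Lsb 0)
  have hloc := isCenteredLocal_comp_chain (P₀ := P₀) hm
    (MemLp.of_bound hm.aestronglyMeasurable 1 (ae_of_all _ fun y => by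
      by_cases h : p.fSb y ∈ p.αSb j <;> simp [h]))
  rwa [hE] at hloc

end WellDefined

lemma integral_const_mul_shiftSum_add {g : (ℕ → 𝔛) → ℝ} {m : ℕ} (hg : IsCenteredLocal P₀ g m)
    (c : ℝ) (e M : ℕ) (E : ℝ) :
    ∫ x, c * (shiftSum g e M x + E) ∂(lawH0 P₀) = c * E := by
  rw [integral_const_mul, integral_add ((hg.memLp_shiftSum e M).integrable (by norm_num))
    (integrable_const _), (hg.sum_shift e M (s' := e * M + m) fun i hi => by
      have := Nat.mul_le_mul_left e hi.le; omega).integral_eq_zero]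
  simp

lemma centeredVec_apply_of_fVec {g : (ℕ → 𝔛) → ℝ} {m : ℕ} (hg : IsCenteredLocal P₀ g m)
    {c E : ℝ} {e M h : ℕ} {j : Fin (p.Ksb + 3)}
    (hf : ∀ x, p.fVec P₀ h x j = c * (shiftSum g e M x + E)) (x : ℕ → 𝔛) :
    p.centeredVec P₀ h x j = c * shiftSum g e M x := by
  have hmean : p.meanZ P₀ h j = c * E := by
    rw [← integral_const_mul_shiftSum_add hg c e M E]
    refine integral_congr_ae (ae_of_all _ fun x => ?_)
    simp only [Z]
    rw [← hf]
    simp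
  rw [centeredVec, PiLp.sub_apply, hmean, hf]
  ring

namespace WellDefined

variable (hp : p.WellDefined P₀)
include hp

lemma centeredVec_idxSum (h : ℕ) (x : ℕ → 𝔛) :
    p.centeredVec P₀ h x p.idxSum =
      (sigmaH0 P₀ p.fSum)⁻¹ * shiftSum (p.centeredSum P₀) 1 h x := by
  refine centeredVec_apply_of_fVec hp.isCenteredLocal_centeredSum
    (E := h * meanH0 P₀ p.fSum) (fun x => ?_) x
  have := sum_comp_chain_eq p.fSum (meanH0 P₀ p.fSum) 1 h x
  simp only [fVec, idxSum]
  rw [dif_neg (by omega), if_neg (by omega)]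
  simp_rw [one_mul] at this
  rw [this]
  rfl

lemma centeredVec_idxLb (h : ℕ) (x : ℕ → 𝔛) :
    p.centeredVec P₀ h x p.idxLb =
      (sigmaH0 P₀ p.fLb)⁻¹ * shiftSum (p.centeredLb P₀) 1 h x := by
  refine centeredVec_apply_of_fVec hp.isCenteredLocal_centeredLb
    (E := h * meanH0 P₀ p.fLb) (fun x => ?_) x
  have := sum_comp_chain_eq p.fLb (meanH0 P₀ p.fLb) 1 h x
  simp only [fVec, idxLb]
  rw [dif_neg (by omega), if_pos trivial]
  simp_rw [one_mul] at this
  rw [this]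
  rfl

lemma centeredVec_idxSb (h : ℕ) (j : Fin (p.Ksb + 1)) (x : ℕ → 𝔛) :
    p.centeredVec P₀ h x (p.idxSb j) =
      (√(p.Esb P₀ j))⁻¹ * shiftSum (p.centeredSb P₀ j) p.Lsb (h / p.Lsb) x := by
  refine centeredVec_apply_of_fVec (hp.isCenteredLocal_centeredSb j)
    (E := (h / p.Lsb : ℕ) * p.Esb P₀ j) (fun x => ?_) x
  have := sum_comp_chain_eq (fun y => (p.αSb j).indicator (1 : ℝ → ℝ) (p.fSb y))
    (p.Esb P₀ j) p.Lsb (h / p.Lsb) x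
  simp only [fVec, idxSb]
  rw [dif_pos j.2, one_div]
  rw [this]
  rfl

lemma isCenteredLocal_centeredVec {s h : ℕ} (hs : p.sMin h ≤ s) (j : Fin (p.Ksb + 3)) :
    IsCenteredLocal P₀ (fun x => p.centeredVec P₀ h x j) s := by
  have h1 := hp.mSum_pos
  have h2 := hp.mLb_pos
  have h3 := le_max_left p.mSum p.mLb
  have h4 := le_max_right p.mSum p.mLb
  unfold sMin at hs
  revert j
  refine forall_index (fun j => ?_) ?_ ?_
  · simp_rw [hp.centeredVec_idxSb]
    refine ((hp.isCenteredLocal_centeredSb j).sum_shift _ _ fun i hi => ?_).const_mul _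
    have h5 := Nat.mul_le_mul_left p.Lsb (show i + 1 ≤ h / p.Lsb from hi)
    have h6 := Nat.mul_div_le h p.Lsb
    rw [mul_add] at h5
    omega
  · simp_rw [hp.centeredVec_idxLb]
    exact (hp.isCenteredLocal_centeredLb.sum_shift _ _ fun i hi => by omega).const_mul _
  · simp_rw [hp.centeredVec_idxSum]
    exact (hp.isCenteredLocal_centeredSum.sum_shift _ _ fun i hi => by omega).const_mul _

lemma isCenteredLocal_inner {s h : ℕ} (hs : p.sMin h ≤ s)
    (t : EuclideanSpace ℝ (Fin (p.Ksb + 3))) :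
    IsCenteredLocal P₀ (fun x => inner ℝ (p.centeredVec P₀ h x) t) s := by
  have e : (fun x => inner ℝ (p.centeredVec P₀ h x) t) =
      fun x => ∑ j, t j * p.centeredVec P₀ h x j := by
    ext x; simp [PiLp.inner_apply]
  rw [e]
  exact IsCenteredLocal.finset_sum _ fun j _ => (hp.isCenteredLocal_centeredVec hs j).const_mul _

end WellDefined

end StatParams

/-! ### The covariance matrix -/

namespace StatParams

variable {𝔛 : Type*} [MeasurableSpace 𝔛] {p : StatParams 𝔛}
  {P₀ : Measure 𝔛} [IsProbabilityMeasure P₀]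

namespace WellDefined

variable (hp : p.WellDefined P₀)
include hp

lemma integrable_Z_apply (h i : ℕ) (j : Fin (p.Ksb + 3)) :
    Integrable (fun x => p.Z P₀ h i x j) (lawH0 P₀) := by
  have h1 := ((hp.isCenteredLocal_centeredVec (h := h) le_rfl j).memLp_shift
    (h * i)).integrable (q := 2) (by norm_num)
  have h2 := h1.add (integrable_const (p.meanZ P₀ h j))
  refine h2.congr (ae_of_all _ fun x => ?_)
  simp only [Pi.add_apply, centeredVec, PiLp.sub_apply, sub_add_cancel]
  rfl

lemma crossCov_Z_apply (h r : ℕ) (a b : Fin (p.Ksb + 3)) :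
    crossCov (lawH0 P₀) (p.Z P₀ h 0) (p.Z P₀ h r) a b =
      ∫ x, p.centeredVec P₀ h x a * p.centeredVec P₀ h (shift (h * r) x) b ∂(lawH0 P₀) := by
  have hmean : ∀ i c, ∫ x, p.Z P₀ h i x c ∂(lawH0 P₀) = p.meanZ P₀ h c := by
    intro i c
    have h0 := (hp.integrable_Z_apply h 0 c).1
    refine (integral_comp_shift (F := fun x => p.fVec P₀ h x c) (by simpa [Z] using h0)
      (h * i)).trans ?_
    simp [meanZ, Z]
  simp only [crossCov, Matrix.of_apply, covariance, hmean]
  refine integral_congr_ae (ae_of_all _ fun x => ?_)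
  simp only [centeredVec, PiLp.sub_apply, Z]
  simp only [mul_zero, zero_add]
  rfl

lemma lagCov_inner {s h : ℕ} (hs : p.sMin h ≤ s) (r : ℕ)
    (t : EuclideanSpace ℝ (Fin (p.Ksb + 3))) :
    lagCov P₀ (fun x => inner ℝ (p.centeredVec P₀ h x) t) h r =
      t ⬝ᵥ crossCov (lawH0 P₀) (p.Z P₀ h 0) (p.Z P₀ h r) *ᵥ t := by
  have hmul : ∀ a b, Integrable (fun x => p.centeredVec P₀ h x a *
      p.centeredVec P₀ h (shift (h * r) x) b) (lawH0 P₀) := fun a b =>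
    (hp.isCenteredLocal_centeredVec hs a).memLp.integrable_mul
      ((hp.isCenteredLocal_centeredVec hs b).memLp_shift (h * r))
  have e : ∀ x, (inner ℝ (p.centeredVec P₀ h x) t : ℝ) *
      inner ℝ (p.centeredVec P₀ h (shift (h * r) x)) t =
      ∑ a, ∑ b, (t a * t b) * (p.centeredVec P₀ h x a *
        p.centeredVec P₀ h (shift (h * r) x) b) := by
    intro x
    simp only [PiLp.inner_apply, Finset.sum_mul_sum]
    refine Finset.sum_congr rfl fun a _ => Finset.sum_congr rfl fun b _ => ?_
    simp
    ring
  rw [lagCov]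
  simp_rw [e]
  rw [integral_finsetSum _ fun a _ => integrable_finsetSum _ fun b _ => (hmul a b).const_mul _]
  simp only [dotProduct, Matrix.mulVec, Finset.mul_sum]
  refine Finset.sum_congr rfl fun a _ => ?_
  rw [integral_finsetSum _ fun b _ => (hmul a b).const_mul _]
  refine Finset.sum_congr rfl fun b _ => ?_
  rw [integral_const_mul, hp.crossCov_Z_apply]
  ring

/-- The quadratic form of `Φ` is the long-run variance of the projections of the vectors `Z`. -/
lemma longRunVar_inner {s h : ℕ} (hs : p.sMin h ≤ s)
    (t : EuclideanSpace ℝ (Fin (p.Ksb + 3))) :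
    longRunVar P₀ (fun x => inner ℝ (p.centeredVec P₀ h x) t) h ((s - 1) / h) =
      t ⬝ᵥ p.Φ P₀ s h *ᵥ t := by
  simp only [longRunVar, hp.lagCov_inner hs, Φ, Matrix.add_mulVec, dotProduct_add,
    Matrix.sum_mulVec, dotProduct_sum]
  congr 1
  rw [Finset.mul_sum]
  refine Finset.sum_congr rfl fun r _ => ?_
  rw [Matrix.mulVec_transpose, dotProduct_comm t.ofLp (Matrix.vecMul _ _),
    ← Matrix.dotProduct_mulVec]
  ring

omit hp in
lemma le_mul_div_add_one {s h : ℕ} (hh : 0 < h) : s ≤ h * ((s - 1) / h + 1) := by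
  have := Nat.lt_mul_div_succ (s - 1) hh
  omega

lemma posSemidef_Φ {s h : ℕ} (hh : 0 < h) (hs : p.sMin h ≤ s) : (p.Φ P₀ s h).PosSemidef := by
  refine .of_dotProduct_mulVec_nonneg ?_ fun t => ?_
  · have h0 : (crossCov (lawH0 P₀) (p.Z P₀ h 0) (p.Z P₀ h 0))ᵀ =
        crossCov (lawH0 P₀) (p.Z P₀ h 0) (p.Z P₀ h 0) := by
      ext a b
      simp [crossCov, covariance_comm]
    rw [Matrix.IsHermitian, Matrix.conjTranspose_eq_transpose_of_trivial, Φ,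
      Matrix.transpose_add, h0, Matrix.transpose_sum]
    congr 1
    refine Finset.sum_congr rfl fun r _ => ?_
    rw [Matrix.transpose_add, Matrix.transpose_transpose]
    exact add_comm _ _
  · have := (hp.isCenteredLocal_inner hs (WithLp.toLp 2 t)).longRunVar_nonneg
      (le_mul_div_add_one hh)
    rw [hp.longRunVar_inner hs] at this
    simpa using this

end WellDefined

end StatParams

/-! ### The blocks -/

section Blocks

/-- The indices `i` with `L k ≤ h i` and `h i + s ≤ L (k + 1)`, over which the vectors `Z` are
summed in the `k`-th block. -/
def blockIdx (s h L k : ℕ) : Finset ℕ :=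
  (Finset.range (L * (k + 1) + 1)).filter fun i => L * k ≤ h * i ∧ h * i + s ≤ L * (k + 1)

/-- The smallest index `i` with `L k ≤ h i`. -/
def blockStart (h L k : ℕ) : ℕ := (L * k + h - 1) / h

variable {s h : ℕ}

lemma mem_blockIdx (hh : 0 < h) {L k i : ℕ} :
    i ∈ blockIdx s h L k ↔ L * k ≤ h * i ∧ h * i + s ≤ L * (k + 1) := by
  simp only [blockIdx, Finset.mem_filter, Finset.mem_range, and_iff_right_iff_imp]
  have := Nat.le_mul_of_pos_left i hh
  omega

lemma blockIdx_eq_Ico (hh : 0 < h) (L k : ℕ) :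
    blockIdx s h L k = Finset.Ico (blockStart h L k) ((L * (k + 1) + h - s) / h) := by
  ext i
  rw [mem_blockIdx hh, Finset.mem_Ico, blockStart, ← Nat.lt_add_one_iff (n := i),
    Nat.div_lt_iff_lt_mul hh, Nat.lt_iff_add_one_le, Nat.lt_iff_add_one_le,
    Nat.le_div_iff_mul_le hh, add_mul, one_mul, mul_comm i h]
  omega

lemma blockIdx_card_bounds (hh : 0 < h) (hs : h ≤ s) (L k : ℕ) :
    h * (blockIdx s h L k).card ≤ L ∧ L ≤ h * (blockIdx s h L k).card + s + h := by
  rw [blockIdx_eq_Ico hh, Nat.card_Ico, blockStart, Nat.mul_sub]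
  have h1 := Nat.div_add_mod (L * k + h - 1) h
  have h2 := Nat.mod_lt (L * k + h - 1) hh
  have h3 := Nat.div_add_mod (L * (k + 1) + h - s) h
  have h4 := Nat.mod_lt (L * (k + 1) + h - s) hh
  have h5 : L * (k + 1) = L * k + L := by ring
  constructor <;> omega

lemma sum_blockIdx {E : Type*} [AddCommMonoid E] (hh : 0 < h) (L k : ℕ) (f : ℕ → E) :
    ∑ i ∈ blockIdx s h L k, f i =
      ∑ i ∈ Finset.range (blockIdx s h L k).card, f (blockStart h L k + i) := by
  rw [blockIdx_eq_Ico hh, Finset.sum_Ico_eq_sum_range, Nat.card_Ico]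

lemma abs_blockIdx_card_sub_le {N : ℕ} (hN : 0 < N) (hh : 0 < h) (hs : h ≤ s) (n k : ℕ) :
    |((blockIdx s h (n / N) k).card : ℝ) - ((N : ℝ) * h)⁻¹ * n| ≤ s + h + 1 := by
  obtain ⟨h1, h2⟩ := blockIdx_card_bounds hh hs (n / N) k
  set M := (blockIdx s h (n / N) k).card
  have h3 := abs_le.1 (abs_natDiv_sub_le hN n)
  have h1' : (h : ℝ) * M ≤ (n / N : ℕ) := by exact_mod_cast h1
  have h2' : ((n / N : ℕ) : ℝ) ≤ h * M + s + h := by exact_mod_cast h2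
  have hh' : (1 : ℝ) ≤ h := by exact_mod_cast hh
  have hh0 : (0 : ℝ) < h := by linarith
  have hbound : |(h : ℝ) * M - (N : ℝ)⁻¹ * n| ≤ s + h + 1 := by
    rw [abs_le]; constructor <;> linarith [h3.1, h3.2, (Nat.cast_nonneg s : (0 : ℝ) ≤ s)]
  have e : (M : ℝ) - ((N : ℝ) * h)⁻¹ * n = (h : ℝ)⁻¹ * (h * M - (N : ℝ)⁻¹ * n) := by
    rw [mul_inv]; field_simp
  rw [e, abs_mul, abs_of_pos (inv_pos.2 hh0)]
  exact (mul_le_of_le_one_left (abs_nonneg _) (inv_le_one_of_one_le₀ hh')).trans hbound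

end Blocks

/-! ### Convergence of the block sums -/

namespace StatParams

variable {𝔛 : Type*} [MeasurableSpace 𝔛] {p : StatParams 𝔛}
  {P₀ : Measure 𝔛} [IsProbabilityMeasure P₀]

lemma X_eq (N s h n k : ℕ) (x : ℕ → 𝔛) :
    p.X P₀ N s h n k x =
      (1 / √(n : ℝ)) • ∑ i ∈ blockIdx s h (n / N) k, p.centeredVec P₀ h (shift (h * i) x) := rfl

namespace WellDefined

variable (hp : p.WellDefined P₀)
include hp

lemma le_sMin (h : ℕ) : h ≤ p.sMin h := by
  have := hp.mSum_pos
  have := le_max_left p.mSum p.mLb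
  unfold sMin
  omega

lemma measurable_centeredVec (h : ℕ) : Measurable (p.centeredVec P₀ h) := by
  have : Measurable fun x (j : Fin (p.Ksb + 3)) => p.centeredVec P₀ h x j :=
    measurable_pi_lambda _ fun j => (hp.isCenteredLocal_centeredVec le_rfl j).measurable
  exact (MeasurableEquiv.toLp 2 _).measurable.comp this

lemma dependsOn_centeredVec {s h : ℕ} (hs : p.sMin h ≤ s) :
    DependsOn (p.centeredVec P₀ h) (Set.Iio s) := by
  intro x y hxy
  ext j
  exact (hp.isCenteredLocal_centeredVec hs j).dependsOn hxy

lemma measurable_X (N s h n k : ℕ) : Measurable (p.X P₀ N s h n k) := by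
  have : Measurable fun x => ∑ i ∈ blockIdx s h (n / N) k,
      p.centeredVec P₀ h (shift (h * i) x) :=
    Finset.measurable_fun_sum _ fun i _ => (hp.measurable_centeredVec h).comp (measurable_shift _)
  exact this.const_smul (1 / √(n : ℝ))

lemma dependsOn_X {N s h : ℕ} (hh : 0 < h) (hs : p.sMin h ≤ s) (n k : ℕ) :
    DependsOn (p.X P₀ N s h n k) (Finset.Ico (n / N * k) (n / N * (k + 1)) : Finset ℕ) := by
  intro x y hxy
  simp only [X_eq]
  congr 1
  refine Finset.sum_congr rfl fun i hi => ?_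
  rw [mem_blockIdx hh] at hi
  refine (hp.dependsOn_centeredVec hs).comp_shift (h * i) fun t ht => hxy t ?_
  simp only [Finset.coe_Ico, Set.mem_Ico] at ht ⊢
  omega

lemma iIndepFun_X {N s h : ℕ} (hh : 0 < h) (hs : p.sMin h ≤ s) (n : ℕ) :
    iIndepFun (fun k : Fin N => p.X P₀ N s h n k) (lawH0 P₀) := by
  refine iIndepFun_of_dependsOn P₀ (fun k => hp.measurable_X N s h n k)
    (fun k => hp.dependsOn_X hh hs n k) ?_
  intro i j hij
  wlog hlt : (i : ℕ) < j generalizing i j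
  · exact (this hij.symm (by have := Fin.val_ne_of_ne hij; omega)).symm
  have : n / N * (i + 1) ≤ n / N * j := Nat.mul_le_mul_left _ hlt
  exact Finset.disjoint_left.2 fun a ha ha' => by
    simp only [Finset.mem_Ico] at ha ha'; omega

/-- The central limit theorem for one block sum, by projection on `t`: the block has about
`n / (N h)` terms, which produces the factor `1 / (N h)` of `Φ`. -/
lemma tendsto_charFun_X {N s h : ℕ} (hN : 0 < N) (hh : 0 < h) (hs : p.sMin h ≤ s) (k : ℕ)
    (t : EuclideanSpace ℝ (Fin (p.Ksb + 3))) :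
    Tendsto (fun n => charFun ((lawH0 P₀).map (p.X P₀ N s h n k)) t) atTop
      (𝓝 (charFun (multivariateGaussian 0 ((1 / ((N : ℝ) * h)) • p.Φ P₀ s h)) t)) := by
  have hhs : h ≤ s := (hp.le_sMin h).trans hs
  have hNh : (0 : ℝ) < (N : ℝ) * h := by positivity
  set M : ℕ → ℕ := fun n => (blockIdx s h (n / N) k).card
  have hMdiv : Tendsto (fun n : ℕ => (M n : ℝ) / n) atTop (𝓝 ((N : ℝ) * h)⁻¹) :=
    tendsto_div_of_abs_sub_le (Eventually.of_forall fun n => abs_blockIdx_card_sub_le hN hh hhs n k)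
  have hM : Tendsto M atTop atTop := by
    have h1 : Tendsto (fun n : ℕ => (M n : ℝ) / n * n) atTop atTop :=
      hMdiv.pos_mul_atTop (inv_pos.2 hNh) tendsto_natCast_atTop_atTop
    refine tendsto_natCast_atTop_iff (R := ℝ).1 (h1.congr' ?_)
    filter_upwards [eventually_gt_atTop 0] with n hn
    have : (n : ℝ) ≠ 0 := by exact_mod_cast hn.ne'
    field_simp
  have hc : Tendsto (fun n : ℕ => 1 / √(n : ℝ) * √(M n)) atTop (𝓝 √((N : ℝ) * h)⁻¹) := by
    refine ((Real.continuous_sqrt.tendsto _).comp hMdiv).congr fun n => ?_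
    simp only [Function.comp_apply]
    rw [Real.sqrt_div (Nat.cast_nonneg _)]
    ring
  have hpsd : ((1 / ((N : ℝ) * h)) • p.Φ P₀ s h).PosSemidef :=
    (hp.posSemidef_Φ hh hs).smul (by positivity)
  have hclt := (hp.isCenteredLocal_inner hs t).tendsto_meanExp_comp (le_mul_div_add_one hh) hM hc
    fun n => h * blockStart h (n / N) k
  rw [hp.longRunVar_inner hs, Real.sq_sqrt (by positivity)] at hclt
  rw [charFun_multivariateGaussian hpsd]
  convert! hclt using 1
  · ext n
    rw [charFun_apply, integral_map (hp.measurable_X N s h n k).aemeasurable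
      (by fun_prop), meanExp]
    refine integral_congr_ae (ae_of_all _ fun x => ?_)
    simp only [X_eq, shiftSum, inner_smul_left, sum_inner, M]
    rw [sum_blockIdx hh]
    simp [shift_shift, mul_add]
  · simp [Matrix.smul_mulVec, neg_div]

lemma tendsto_map_X {N s h : ℕ} (hN : 0 < N) (hh : 0 < h) (hs : p.sMin h ≤ s) (k : ℕ) :
    Tendsto (β := ProbabilityMeasure (EuclideanSpace ℝ (Fin (p.Ksb + 3))))
      (fun n => ⟨(lawH0 P₀).map (p.X P₀ N s h n k),
        Measure.isProbabilityMeasure_map (hp.measurable_X N s h n k).aemeasurable⟩) atTop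
      (𝓝 ⟨multivariateGaussian 0 ((1 / ((N : ℝ) * h)) • p.Φ P₀ s h), inferInstance⟩) :=
  ProbabilityMeasure.tendsto_iff_tendsto_charFun.2 fun t => hp.tendsto_charFun_X hN hh hs k t

/-- The block sums converge jointly to independent Gaussian vectors. -/
theorem tendstoInDistribution_X {N s h : ℕ} (hN : 0 < N) (hh : 0 < h) (hs : p.sMin h ≤ s)
    {Ω' : Type*} [MeasurableSpace Ω'] {P' : Measure Ω'} [IsProbabilityMeasure P']
    {η : ℕ → Ω' → EuclideanSpace ℝ (Fin (p.Ksb + 3))}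
    (hη_indep : iIndepFun (fun k : Fin N => η k) P')
    (hη_law : ∀ k < N,
      HasLaw (η k) (multivariateGaussian 0 ((1 / ((N : ℝ) * h)) • p.Φ P₀ s h)) P') :
    TendstoInDistribution (fun n x => fun k : Fin N => p.X P₀ N s h n k x) atTop
      (fun ω => fun k : Fin N => η k ω) (fun _ => lawH0 P₀) P' where
  forall_aemeasurable n :=
    (measurable_pi_lambda _ fun k : Fin N => hp.measurable_X N s h n k).aemeasurable
  aemeasurable_limit := aemeasurable_pi_lambda _ fun k => (hη_law k k.2).aemeasurable
  tendsto := by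
    set ν : ℕ → Fin N → ProbabilityMeasure (EuclideanSpace ℝ (Fin (p.Ksb + 3))) :=
      fun n k => ⟨(lawH0 P₀).map (p.X P₀ N s h n k),
        Measure.isProbabilityMeasure_map (hp.measurable_X N s h n k).aemeasurable⟩
    set ν₀ : Fin N → ProbabilityMeasure (EuclideanSpace ℝ (Fin (p.Ksb + 3))) := fun _ =>
      ⟨multivariateGaussian 0 ((1 / ((N : ℝ) * h)) • p.Φ P₀ s h), inferInstance⟩
    have h1 : Tendsto ν atTop (𝓝 ν₀) :=
      tendsto_pi_nhds.2 fun k => hp.tendsto_map_X hN hh hs k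
    have h2 := (ProbabilityMeasure.continuous_pi.tendsto _).comp h1
    have e : ProbabilityMeasure.pi ν₀ = ⟨P'.map fun ω => fun k : Fin N => η k ω,
        Measure.isProbabilityMeasure_map
          (aemeasurable_pi_lambda _ fun k : Fin N => (hη_law k k.2).aemeasurable)⟩ :=
      Subtype.ext (hη_indep.hasLaw_pi fun k : Fin N => hη_law k k.2).map_eq.symm
    rw [← e]
    exact h2.congr fun n => Subtype.ext ((hp.iIndepFun_X hh hs n).map_fun_eq_pi_map
      (f := fun k : Fin N => p.X P₀ N s h n k)
        fun k => (hp.measurable_X N s h n k).aemeasurable).symm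

end WellDefined

end StatParams

/-! ### Closeness in mean -/

section MeanClose

variable {Ω : Type*} [MeasurableSpace Ω] {μ : Measure Ω}

/-- The differences of two sequences of random variables are integrable, except for finitely many
of them, and tend to zero in `L¹`. -/
def MeanClose (μ : Measure Ω) (A B : ℕ → Ω → ℝ) : Prop :=
  (∀ᶠ n in atTop, Integrable (fun x => A n x - B n x) μ) ∧
    Tendsto (fun n => ∫ x, |A n x - B n x| ∂μ) atTop (𝓝 0)

lemma MeanClose.congr {A B A' B' : ℕ → Ω → ℝ} (h : MeanClose μ A' B')
    (hA : ∀ᶠ n in atTop, ∀ x, A n x = A' n x) (hB : ∀ᶠ n in atTop, ∀ x, B n x = B' n x) :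
    MeanClose μ A B := by
  refine ⟨?_, h.2.congr' ?_⟩
  · filter_upwards [h.1, hA, hB] with n hn h1 h2
    simpa only [h1, h2] using hn
  · filter_upwards [hA, hB] with n h1 h2
    simp only [h1, h2]

lemma MeanClose.sum {ι : Type*} (I : Finset ι) {A B : ι → ℕ → Ω → ℝ}
    (h : ∀ i ∈ I, MeanClose μ (A i) (B i)) :
    MeanClose μ (fun n x => ∑ i ∈ I, A i n x) (fun n x => ∑ i ∈ I, B i n x) := by
  have hint : ∀ᶠ n in atTop, ∀ i ∈ I, Integrable (fun x => A i n x - B i n x) μ :=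
    (eventually_all_finset I).2 fun i hi => (h i hi).1
  have hlim : Tendsto (fun n => ∑ i ∈ I, ∫ x, |A i n x - B i n x| ∂μ) atTop (𝓝 0) := by
    simpa using tendsto_finsetSum I fun i hi => (h i hi).2
  refine ⟨?_, squeeze_zero' (Eventually.of_forall fun n => integral_nonneg fun _ => abs_nonneg _)
    ?_ hlim⟩
  · filter_upwards [hint] with n hn
    simpa only [Finset.sum_sub_distrib] using integrable_finsetSum I hn
  · filter_upwards [hint] with n hn
    rw [← integral_finsetSum I fun i hi => (hn i hi).abs]
    refine integral_mono_of_nonneg (ae_of_all _ fun _ => abs_nonneg _)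
      (integrable_finsetSum I fun i hi => (hn i hi).abs) (ae_of_all _ fun x => ?_)
    simp only [← Finset.sum_sub_distrib]
    exact Finset.abs_sum_le_sum_abs _ _

lemma tendsto_measure_le_of_tendsto_integral {f : ℕ → Ω → ℝ} (h0 : ∀ n x, 0 ≤ f n x)
    (hint : ∀ᶠ n in atTop, Integrable (f n) μ)
    (hlim : Tendsto (fun n => ∫ x, f n x ∂μ) atTop (𝓝 0)) {δ : ℝ} (hδ : 0 < δ) :
    Tendsto (fun n => μ {x | δ ≤ f n x}) atTop (𝓝 0) := by
  have h1 : Tendsto (fun n => ENNReal.ofReal (∫ x, f n x ∂μ) / ENNReal.ofReal δ) atTop (𝓝 0) := by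
    have := ENNReal.Tendsto.div_const (ENNReal.tendsto_ofReal hlim)
      (b := ENNReal.ofReal δ) (Or.inr (ENNReal.ofReal_pos.2 hδ).ne')
    simpa using this
  refine tendsto_of_tendsto_of_tendsto_of_le_of_le' tendsto_const_nhds h1
    (Eventually.of_forall fun _ => zero_le) ?_
  filter_upwards [hint] with n hn
  rw [ENNReal.le_div_iff_mul_le (Or.inl (ENNReal.ofReal_pos.2 hδ).ne')
    (Or.inl ENNReal.ofReal_ne_top), mul_comm,
    ofReal_integral_eq_lintegral_ofReal hn (ae_of_all _ (h0 n))]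
  refine le_trans (mul_le_mul_right (measure_mono fun x hx => ?_) _)
    (mul_meas_ge_le_lintegral₀ hn.aemeasurable.ennreal_ofReal _)
  exact ENNReal.ofReal_le_ofReal hx

lemma meanClose_of_tendsto_integral_sq [IsProbabilityMeasure μ] {A B : ℕ → Ω → ℝ}
    (hA : ∀ n, MemLp (A n) 2 μ) (hB : ∀ n, MemLp (B n) 2 μ)
    (h : Tendsto (fun n => ∫ x, (A n x - B n x) ^ 2 ∂μ) atTop (𝓝 0)) : MeanClose μ A B := by
  have hAB : ∀ n, MemLp (fun x => A n x - B n x) 2 μ := fun n => (hA n).sub (hB n)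
  refine ⟨Eventually.of_forall fun n => (hAB n).integrable (by norm_num), ?_⟩
  refine squeeze_zero (fun n => integral_nonneg fun _ => abs_nonneg _)
    (fun n => integral_abs_le_sqrt (hAB n)) ?_
  simpa [Function.comp_def] using (Real.continuous_sqrt.tendsto _).comp h

/-- Squares are close in mean if the variables are close in mean square and bounded in mean
square. -/
lemma meanClose_sq_of_tendsto_integral_sq {A B : ℕ → Ω → ℝ} (hA : ∀ n, MemLp (A n) 2 μ)
    (hB : ∀ n, MemLp (B n) 2 μ) {C : ℝ} (hC : ∀ᶠ n in atTop, ∫ x, A n x ^ 2 ∂μ ≤ C)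
    (h : Tendsto (fun n => ∫ x, (A n x - B n x) ^ 2 ∂μ) atTop (𝓝 0)) :
    MeanClose μ (fun n x => A n x ^ 2) (fun n x => B n x ^ 2) := by
  have hAB : ∀ n, MemLp (fun x => A n x - B n x) 2 μ := fun n => (hA n).sub (hB n)
  have hint : ∀ n, Integrable (fun x => A n x ^ 2 - B n x ^ 2) μ := fun n =>
    (hA n).integrable_sq.sub (hB n).integrable_sq
  have hC0 : 0 ≤ C := by
    obtain ⟨n, hn⟩ := hC.exists
    exact (integral_nonneg fun _ => sq_nonneg _).trans hn
  refine ⟨Eventually.of_forall hint, ?_⟩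
  rw [Metric.tendsto_nhds]
  intro ε hε
  set δ := ε / (2 * (C + 1)) with hδ
  have hδ0 : 0 < δ := by positivity
  have hlim : Tendsto (fun n => (δ⁻¹ + 1) * ∫ x, (A n x - B n x) ^ 2 ∂μ) atTop (𝓝 0) := by
    simpa using h.const_mul (δ⁻¹ + 1)
  filter_upwards [hC, hlim.eventually_lt_const (half_pos hε)] with n hn hn'
  rw [Real.dist_eq, sub_zero, abs_of_nonneg (integral_nonneg fun _ => abs_nonneg _)]
  have hbound : ∫ x, |A n x ^ 2 - B n x ^ 2| ∂μ ≤
      δ * ∫ x, A n x ^ 2 ∂μ + (δ⁻¹ + 1) * ∫ x, (A n x - B n x) ^ 2 ∂μ := by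
    rw [← integral_const_mul, ← integral_const_mul,
      ← integral_add ((hA n).integrable_sq.const_mul _) ((hAB n).integrable_sq.const_mul _)]
    refine integral_mono (hint n).abs
      (((hA n).integrable_sq.const_mul _).add ((hAB n).integrable_sq.const_mul _)) fun x => ?_
    -- with `d = A - B`, this is `|2 A d - d ^ 2| ≤ δ A ^ 2 + d ^ 2 / δ + d ^ 2`
    have e1 : δ⁻¹ * (δ * A n x - (A n x - B n x)) ^ 2 =
        δ * A n x ^ 2 - 2 * A n x * (A n x - B n x) + δ⁻¹ * (A n x - B n x) ^ 2 := by
      field_simp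
      ring
    have e2 : δ⁻¹ * (δ * A n x + (A n x - B n x)) ^ 2 =
        δ * A n x ^ 2 + 2 * A n x * (A n x - B n x) + δ⁻¹ * (A n x - B n x) ^ 2 := by
      field_simp
      ring
    have p1 : 0 ≤ δ⁻¹ * (δ * A n x - (A n x - B n x)) ^ 2 := by positivity
    have p2 : 0 ≤ δ⁻¹ * (δ * A n x + (A n x - B n x)) ^ 2 := by positivity
    rw [e1] at p1
    rw [e2] at p2
    change |A n x ^ 2 - B n x ^ 2| ≤
      δ * A n x ^ 2 + (δ⁻¹ + 1) * (A n x - B n x) ^ 2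
    rw [abs_le]
    constructor <;> nlinarith [sq_nonneg (A n x - B n x)]
  have h1 : δ * ∫ x, A n x ^ 2 ∂μ ≤ ε / 2 := by
    calc δ * ∫ x, A n x ^ 2 ∂μ ≤ δ * (C + 1) :=
          mul_le_mul_of_nonneg_left (by linarith) hδ0.le
      _ = ε / 2 := by rw [hδ]; field_simp
  linarith

end MeanClose

/-! ### Comparison of sums over almost the same indices -/

section Comparison

variable {𝔛 : Type*} [MeasurableSpace 𝔛] {P₀ : Measure 𝔛} [IsProbabilityMeasure P₀]
  {g : (ℕ → 𝔛) → ℝ} {s h q : ℕ}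

/-- The sum of the shifts of `g` by `h * i` over the indices `i` of a set. -/
def shiftSumOn (g : (ℕ → 𝔛) → ℝ) (h : ℕ) (I : Finset ℕ) (x : ℕ → 𝔛) : ℝ :=
  ∑ i ∈ I, g (shift (h * i) x)

namespace IsCenteredLocal

lemma memLp_shiftSumOn (hg : IsCenteredLocal P₀ g s) (h : ℕ) (I : Finset ℕ) :
    MemLp (shiftSumOn g h I) 2 (lawH0 P₀) :=
  memLp_finsetSum _ fun _ _ => hg.memLp_shift _

lemma integral_sq_shiftSumOn_le_card (hg : IsCenteredLocal P₀ g s) (h : ℕ) (I : Finset ℕ) {C : ℝ}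
    (hI : I.card ≤ C) :
    ∫ x, shiftSumOn g h I x ^ 2 ∂(lawH0 P₀) ≤ C ^ 2 * lagCov P₀ g h 0 := by
  refine (integral_sq_sum_le I fun i _ => hg.memLp_shift (h * i)).trans ?_
  simp_rw [hg.integral_sq_shift h]
  rw [Finset.sum_const, nsmul_eq_mul, ← mul_assoc, ← sq]
  exact mul_le_mul_of_nonneg_right (pow_le_pow_left₀ (Nat.cast_nonneg _) hI 2)
    (lagCov_zero_nonneg g h)

lemma integral_sq_shiftSumOn_Ico_le (hg : IsCenteredLocal P₀ g s) (hq : s ≤ h * (q + 1))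
    (a b : ℕ) :
    ∫ x, shiftSumOn g h (Finset.Ico a b) x ^ 2 ∂(lawH0 P₀) ≤
      b * ((1 + 2 * q) * lagCov P₀ g h 0) := by
  have e : ∀ x, shiftSumOn g h (Finset.Ico a b) x = shiftSum g h (b - a) (shift (h * a) x) := by
    intro x
    simp [shiftSumOn, shiftSum, Finset.sum_Ico_eq_sum_range, shift_shift, mul_add]
  simp_rw [e]
  rw [integral_comp_shift (F := fun x => shiftSum g h (b - a) x ^ 2)
    ((hg.memLp_shiftSum h _).1.pow 2)]
  refine (hg.integral_sq_shiftSum_le hq _).trans (mul_le_mul_of_nonneg_right ?_ ?_)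
  · exact_mod_cast Nat.sub_le b a
  · have := lagCov_zero_nonneg (P₀ := P₀) g h
    positivity

omit [MeasurableSpace 𝔛] in
lemma shiftSumOn_eq_sub {I H : Finset ℕ} (hI : I ⊆ H) (x : ℕ → 𝔛) :
    shiftSumOn g h I x = shiftSumOn g h H x - shiftSumOn g h (H \ I) x := by
  simp only [shiftSumOn]
  rw [← Finset.sum_sdiff hI]
  ring

/-- Both sums are compared with the sum over the whole interval: replacing the factor costs a
variance of order `b`, and the missing indices cost a bounded second moment. -/
lemma integral_sq_mul_sub_mul_le (hg : IsCenteredLocal P₀ g s) (hq : s ≤ h * (q + 1)) (α β : ℝ)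
    {a b : ℕ} {I J : Finset ℕ} {C : ℕ} (hI : I ⊆ Finset.Ico a b) (hJ : J ⊆ Finset.Ico a b)
    (hIc : b - a ≤ I.card + C) (hJc : b - a ≤ J.card + C) :
    ∫ x, (α * shiftSumOn g h I x - β * shiftSumOn g h J x) ^ 2 ∂(lawH0 P₀) ≤
      2 * ((α - β) ^ 2 * (b * ((1 + 2 * q) * lagCov P₀ g h 0))) +
        2 * (2 * (β ^ 2 * ((C : ℝ) ^ 2 * lagCov P₀ g h 0)) +
          2 * (α ^ 2 * ((C : ℝ) ^ 2 * lagCov P₀ g h 0))) := by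
  set H := Finset.Ico a b
  have hcard : ∀ {I : Finset ℕ}, I ⊆ H → b - a ≤ I.card + C → (((H \ I).card : ℕ) : ℝ) ≤ C := by
    intro I hI hIc
    rw [Finset.card_sdiff_of_subset hI, Nat.card_Ico]
    exact_mod_cast (by omega : b - a - I.card ≤ C)
  have hm := hg.memLp_shiftSumOn h
  have e : ∀ x, α * shiftSumOn g h I x - β * shiftSumOn g h J x =
      (α - β) * shiftSumOn g h H x +
        (β * shiftSumOn g h (H \ J) x + -α * shiftSumOn g h (H \ I) x) := by
    intro x
    rw [shiftSumOn_eq_sub hI, shiftSumOn_eq_sub hJ]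
    ring
  simp_rw [e]
  refine (integral_add_sq_le ((hm _).const_mul _)
    (((hm _).const_mul _).add ((hm _).const_mul _))).trans ?_
  refine add_le_add ?_ (mul_le_mul_of_nonneg_left ((integral_add_sq_le ((hm _).const_mul _)
    ((hm _).const_mul _)).trans (add_le_add ?_ ?_)) two_pos.le)
  all_goals
    simp_rw [mul_pow, integral_const_mul]
    refine mul_le_mul_of_nonneg_left ?_ two_pos.le
  · exact mul_le_mul_of_nonneg_left (hg.integral_sq_shiftSumOn_Ico_le hq a b) (sq_nonneg _)
  · exact mul_le_mul_of_nonneg_left (hg.integral_sq_shiftSumOn_le_card h _ (hcard hJ hJc))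
      (sq_nonneg _)
  · rw [neg_sq]
    exact mul_le_mul_of_nonneg_left (hg.integral_sq_shiftSumOn_le_card h _ (hcard hI hIc))
      (sq_nonneg _)

/-- Two sums over index sets that exhaust an interval up to boundedly many indices, with
asymptotically equal normalizing factors of order `1 / √n`, are close in mean square. -/
lemma tendsto_integral_sq_sub (hg : IsCenteredLocal P₀ g s) (hq : s ≤ h * (q + 1)) {α β : ℕ → ℝ}
    {c : ℝ} (hα : Tendsto (fun n : ℕ => √(n : ℝ) * α n) atTop (𝓝 c))
    (hβ : Tendsto (fun n : ℕ => √(n : ℝ) * β n) atTop (𝓝 c)) {a b : ℕ → ℕ} {I J : ℕ → Finset ℕ}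
    {C : ℕ} (hb : ∀ n, b n ≤ n) (hI : ∀ n, I n ⊆ Finset.Ico (a n) (b n))
    (hJ : ∀ n, J n ⊆ Finset.Ico (a n) (b n)) (hIc : ∀ n, b n - a n ≤ (I n).card + C)
    (hJc : ∀ n, b n - a n ≤ (J n).card + C) :
    Tendsto (fun n => ∫ x, (α n * shiftSumOn g h (I n) x - β n * shiftSumOn g h (J n) x) ^ 2
      ∂(lawH0 P₀)) atTop (𝓝 0) := by
  have hγ := lagCov_zero_nonneg (P₀ := P₀) g h
  set D := (1 + 2 * q) * lagCov P₀ g h 0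
  set D' := (C : ℝ) ^ 2 * lagCov P₀ g h 0
  have hinv : Tendsto (fun n : ℕ => (√(n : ℝ))⁻¹) atTop (𝓝 0) :=
    tendsto_inv_atTop_zero.comp (Real.tendsto_sqrt_atTop.comp tendsto_natCast_atTop_atTop)
  have hzero : ∀ {γ : ℕ → ℝ}, Tendsto (fun n : ℕ => √(n : ℝ) * γ n) atTop (𝓝 c) →
      Tendsto γ atTop (𝓝 0) := by
    intro γ hγ
    have h1 := hinv.mul hγ
    rw [zero_mul] at h1
    refine h1.congr' ?_
    filter_upwards [eventually_gt_atTop 0] with n hn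
    have : √(n : ℝ) ≠ 0 := (Real.sqrt_pos.2 (by exact_mod_cast hn)).ne'
    field_simp
  have hlim : Tendsto (fun n : ℕ => 2 * ((√(n : ℝ) * α n - √(n : ℝ) * β n) ^ 2 * D) +
      2 * (2 * (β n ^ 2 * D') + 2 * (α n ^ 2 * D'))) atTop (𝓝 0) := by
    have := ((((hα.sub hβ).pow 2).mul_const D).const_mul 2).add
      (((((hzero hβ).pow 2).mul_const D').const_mul 2).add
        ((((hzero hα).pow 2).mul_const D').const_mul 2) |>.const_mul 2)
    simpa using this
  refine squeeze_zero (fun n => integral_nonneg fun _ => sq_nonneg _) (fun n => ?_) hlim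
  refine (hg.integral_sq_mul_sub_mul_le hq (α n) (β n) (hI n) (hJ n) (hIc n) (hJc n)).trans ?_
  have hn : (b n : ℝ) ≤ n := by exact_mod_cast hb n
  rw [← mul_sub, mul_pow, Real.sq_sqrt (Nat.cast_nonneg n)]
  have hD : 0 ≤ D := by positivity
  have : (α n - β n) ^ 2 * (b n * D) ≤ n * (α n - β n) ^ 2 * D := by
    calc (α n - β n) ^ 2 * (b n * D) ≤ (α n - β n) ^ 2 * (n * D) :=
          mul_le_mul_of_nonneg_left (mul_le_mul_of_nonneg_right hn hD) (sq_nonneg _)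
      _ = n * (α n - β n) ^ 2 * D := by ring
  linarith

/-- Normalized sums over intervals are bounded in mean square. -/
lemma eventually_integral_sq_le (hg : IsCenteredLocal P₀ g s) (hq : s ≤ h * (q + 1)) {α : ℕ → ℝ}
    {c : ℝ} (hα : Tendsto (fun n : ℕ => √(n : ℝ) * α n) atTop (𝓝 c)) (a b : ℕ → ℕ)
    (hb : ∀ n, b n ≤ n) :
    ∃ K : ℝ, ∀ᶠ n in atTop,
      ∫ x, (α n * shiftSumOn g h (Finset.Ico (a n) (b n)) x) ^ 2 ∂(lawH0 P₀) ≤ K := by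
  have hγ := lagCov_zero_nonneg (P₀ := P₀) g h
  set D := (1 + 2 * q) * lagCov P₀ g h 0
  have hD : 0 ≤ D := by positivity
  refine ⟨(c ^ 2 + 1) * D, ?_⟩
  filter_upwards [(hα.pow 2).eventually_lt_const (lt_add_one (c ^ 2))] with n hn
  rw [mul_pow, Real.sq_sqrt (Nat.cast_nonneg n)] at hn
  simp_rw [mul_pow, integral_const_mul]
  have hbn : (b n : ℝ) ≤ n := by exact_mod_cast hb n
  calc α n ^ 2 * ∫ x, shiftSumOn g h (Finset.Ico (a n) (b n)) x ^ 2 ∂(lawH0 P₀)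
      ≤ α n ^ 2 * (n * D) := mul_le_mul_of_nonneg_left
        ((hg.integral_sq_shiftSumOn_Ico_le hq _ _).trans
          (mul_le_mul_of_nonneg_right hbn hD)) (sq_nonneg _)
    _ = n * α n ^ 2 * D := by ring
    _ ≤ (c ^ 2 + 1) * D := mul_le_mul_of_nonneg_right hn.le hD

end IsCenteredLocal

end Comparison

/-! ### The indices covered by the blocks -/

section Units

variable {s h e r : ℕ}

/-- The indices of the summands, `r` for every vector `Z`, in the sums over the blocks with numbers
in `T`. -/
def unitIdx (s h L r : ℕ) (T : Finset ℕ) : Finset ℕ :=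
  ((T.biUnion (blockIdx s h L)) ×ˢ Finset.range r).image fun v => r * v.1 + v.2

lemma injOn_unit (A : Finset ℕ) (r : ℕ) :
    Set.InjOn (fun v : ℕ × ℕ => r * v.1 + v.2) (A ×ˢ Finset.range r : Finset (ℕ × ℕ)) := by
  rintro ⟨i, u⟩ hv ⟨i', u'⟩ hv' heq
  simp only [Finset.coe_product, Set.mem_prod, Finset.mem_coe, Finset.mem_range] at hv hv' heq
  have hr : 0 < r := by omega
  have h1 : i = i' := by
    have := congrArg (· / r) heq
    simpa [Nat.mul_add_div hr, Nat.div_eq_of_lt hv.2, Nat.div_eq_of_lt hv'.2] using this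
  subst h1
  simpa using heq

lemma disjoint_blockIdx (hh : 0 < h) (hs : h ≤ s) (L : ℕ) {k l : ℕ} (hkl : k ≠ l) :
    Disjoint (blockIdx s h L k) (blockIdx s h L l) := by
  wlog hlt : k < l generalizing k l
  · exact (this hkl.symm (by omega)).symm
  have : L * (k + 1) ≤ L * l := Nat.mul_le_mul_left L hlt
  exact Finset.disjoint_left.2 fun i hi hi' => by
    rw [mem_blockIdx hh] at hi hi'; omega

lemma sum_unitIdx {E : Type*} [AddCommMonoid E] (hh : 0 < h) (hs : h ≤ s) (L r : ℕ)
    (T : Finset ℕ) (f : ℕ → E) :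
    ∑ v ∈ unitIdx s h L r T, f v =
      ∑ k ∈ T, ∑ i ∈ blockIdx s h L k, ∑ u ∈ Finset.range r, f (r * i + u) := by
  rw [unitIdx, Finset.sum_image (injOn_unit _ r), Finset.sum_product, Finset.sum_biUnion]
  exact fun k _ l _ hkl => disjoint_blockIdx hh hs L hkl

lemma card_unitIdx (hh : 0 < h) (hs : h ≤ s) (L r : ℕ) (T : Finset ℕ) :
    (unitIdx s h L r T).card = r * ∑ k ∈ T, (blockIdx s h L k).card := by
  rw [Finset.card_eq_sum_ones, sum_unitIdx hh hs]
  simp [Finset.mul_sum, mul_comm]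

lemma le_mul_card_unitIdx (hh : 0 < h) (hs : h ≤ s) (her : e * r = h) (L : ℕ) (T : Finset ℕ) :
    T.card * L ≤ e * (unitIdx s h L r T).card + T.card * (s + h) := by
  rw [card_unitIdx hh hs, ← mul_assoc, her, Finset.mul_sum, ← smul_eq_mul, ← smul_eq_mul,
    ← Finset.sum_const, ← Finset.sum_const, ← Finset.sum_add_distrib]
  refine Finset.sum_le_sum fun k _ => ?_
  have := (blockIdx_card_bounds hh hs L k).2
  omega

lemma bounds_of_mem_unitIdx (hh : 0 < h) (hs : h ≤ s) (her : e * r = h) {L a b v : ℕ}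
    (hv : v ∈ unitIdx s h L r (Finset.Ico a b)) : L * a ≤ e * v ∧ e * v + e ≤ L * b := by
  simp only [unitIdx, Finset.mem_image, Finset.mem_product, Finset.mem_biUnion, Finset.mem_Ico,
    Finset.mem_range, Prod.exists] at hv
  obtain ⟨i, u, ⟨⟨k, hk, hi⟩, hu⟩, rfl⟩ := hv
  rw [mem_blockIdx hh] at hi
  have h1 : L * a ≤ L * k := Nat.mul_le_mul_left L hk.1
  have h2 : L * (k + 1) ≤ L * b := Nat.mul_le_mul_left L hk.2
  have h3 : e * (u + 1) ≤ e * r := Nat.mul_le_mul_left e hu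
  have h4 : e * (r * i + u) = h * i + e * u := by rw [← her]; ring
  rw [h4]
  rw [mul_add, mul_one] at h3
  omega

end Units

/-! ### The expansions of the three statistics -/

lemma sum_range_groupSum {E : Type*} [AddCommMonoid E] (N Nlb : ℕ) (v : ℕ → E) (K : ℕ) :
    ∑ k ∈ Finset.range K, groupSum N Nlb v k = ∑ t ∈ Finset.range (N / Nlb * K), v t := by
  induction K with
  | zero => simp
  | succ K ih => rw [Finset.sum_range_succ, ih, mul_add, mul_one, Finset.sum_range_add, groupSum]

lemma groupSum_eq_sum_Ico {E : Type*} [AddCommMonoid E] (N Nlb : ℕ) (v : ℕ → E) (k : ℕ) :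
    groupSum N Nlb v k = ∑ t ∈ Finset.Ico (N / Nlb * k) (N / Nlb * k + N / Nlb), v t := by
  rw [groupSum, Finset.sum_Ico_eq_sum_range, Nat.add_sub_cancel_left]

lemma groupSum_apply {d : ℕ} (N Nlb : ℕ) (v : ℕ → EuclideanSpace ℝ (Fin d)) (k : ℕ) (j : Fin d) :
    groupSum N Nlb v k j = groupSum N Nlb (fun t => v t j) k := by
  simp [groupSum]

lemma tendsto_sqrt_mul_inv_sqrt {m : ℕ → ℝ} {κ : ℝ} (hm0 : ∀ᶠ n in atTop, 0 < m n)
    (hm : Tendsto (fun n : ℕ => m n / n) atTop (𝓝 κ)) (hκ : 0 < κ) :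
    Tendsto (fun n : ℕ => √(n : ℝ) * (√(m n))⁻¹) atTop (𝓝 (√κ)⁻¹) := by
  have h1 := ((Real.continuous_sqrt.tendsto _).comp hm).inv₀ (Real.sqrt_pos.2 hκ).ne'
  refine h1.congr' ?_
  filter_upwards [hm0, eventually_gt_atTop 0] with n hn hn0
  simp only [Function.comp_apply]
  rw [Real.sqrt_div hn.le, inv_div, div_eq_mul_inv]

lemma tendsto_sqrt_mul_div_sqrt (c : ℝ) :
    Tendsto (fun n : ℕ => √(n : ℝ) * (c / √(n : ℝ))) atTop (𝓝 c) := by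
  refine tendsto_const_nhds.congr' ?_
  filter_upwards [eventually_gt_atTop 0] with n hn
  have : √(n : ℝ) ≠ 0 := (Real.sqrt_pos.2 (by exact_mod_cast hn)).ne'
  field_simp

/-- All but boundedly many of the summands of a statistic with steps of length `e` are covered by
the `N` blocks. -/
lemma le_card_unitIdx_add {N s h e r n : ℕ} (hN : 0 < N) (hh : 0 < h) (hs : h ≤ s)
    (he : 0 < e) (her : e * r = h) :
    n / e ≤ (unitIdx s h (n / N) r (Finset.Ico 0 N)).card + N * (s + h + 1) := by
  have h1 := le_mul_card_unitIdx hh hs her (n / N) (Finset.Ico 0 N)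
  rw [Nat.card_Ico, Nat.sub_zero] at h1
  have h2 := Nat.lt_mul_div_succ n hN
  set M := (unitIdx s h (n / N) r (Finset.Ico 0 N)).card
  have h3 : N * (s + h + 1) ≤ e * (N * (s + h + 1)) := Nat.le_mul_of_pos_left _ he
  have h4 := Nat.mul_div_le n e
  refine Nat.le_of_mul_le_mul_left (h4.trans ?_) he
  rw [mul_add e]
  have h5 : N * (s + h + 1) = N * (s + h) + N := by ring
  rw [mul_add N, mul_one] at h2
  omega

lemma unitIdx_subset {N s h e r n : ℕ} (hh : 0 < h) (hs : h ≤ s) (he : 0 < e)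
    (her : e * r = h) : unitIdx s h (n / N) r (Finset.Ico 0 N) ⊆ Finset.Ico 0 (n / e) := by
  intro v hv
  have h1 := (bounds_of_mem_unitIdx hh hs her hv).2
  have h2 := Nat.div_mul_le_self n N
  rw [Finset.mem_Ico]
  refine ⟨Nat.zero_le _, Nat.lt_of_lt_of_le (Nat.lt_succ_self v) ?_⟩
  rw [Nat.le_div_iff_mul_le he, Nat.succ_mul, mul_comm v]
  omega

/-- The blocks of the `k`-th group cover all but boundedly many indices of the part of the sequence
from the beginning of the group to the end of the `k`-th long block. -/
lemma le_card_unitIdx_group_add {s h G n k : ℕ} (hh : 0 < h) (hhs : h ≤ s) (hG : 0 < G)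
    (L : ℕ) (hL : L = n / G) :
    n * (k + 1) - L * (G * k) ≤
      (unitIdx s h L h (Finset.Ico (G * k) (G * k + G))).card + G * (k + s + h + 1) := by
  have h1 := le_mul_card_unitIdx hh hhs (one_mul h) L (Finset.Ico (G * k) (G * k + G))
  rw [Nat.card_Ico, Nat.add_sub_cancel_left, one_mul] at h1
  have h2 : n < G * (L + 1) := hL ▸ Nat.lt_mul_div_succ n hG
  have h3 : n * k ≤ G * (L + 1) * k := Nat.mul_le_mul_right k h2.le
  have e1 : G * (L + 1) * k = L * (G * k) + G * k := by ring
  have e2 : G * (L + 1) = G * L + G := by ring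
  have e3 : G * (k + s + h + 1) = G * k + G * (s + h) + G := by ring
  have e4 : n * (k + 1) = n * k + n := by ring
  omega

namespace StatParams

variable {𝔛 : Type*} [MeasurableSpace 𝔛] {p : StatParams 𝔛}
  {P₀ : Measure 𝔛} [IsProbabilityMeasure P₀]

/-- A coordinate of a sum of vectors `𝒳` is a normalized sum of shifts of the summand of the
corresponding statistic. -/
lemma sum_X_apply {N s h e r : ℕ} (hh : 0 < h) (hs : h ≤ s) (her : e * r = h)
    {g : (ℕ → 𝔛) → ℝ} {c : ℝ} {j : Fin (p.Ksb + 3)}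
    (hf : ∀ x, p.centeredVec P₀ h x j = c * shiftSum g e r x) (T : Finset ℕ) (n : ℕ)
    (x : ℕ → 𝔛) :
    ∑ t ∈ T, p.X P₀ N s h n t x j =
      c / √(n : ℝ) * shiftSumOn g e (unitIdx s h (n / N) r T) x := by
  rw [shiftSumOn, sum_unitIdx hh hs, Finset.mul_sum]
  refine Finset.sum_congr rfl fun k _ => ?_
  rw [X_eq, PiLp.smul_apply, WithLp.ofLp_sum, Finset.sum_apply, Finset.mul_sum, smul_eq_mul,
    Finset.mul_sum]
  refine Finset.sum_congr rfl fun i _ => ?_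
  rw [hf, shiftSum]
  have : ∀ u, shift (e * u) (shift (h * i) x) = shift (e * (r * i + u)) x := by
    intro u
    rw [shift_shift, ← her]
    congr 1
    ring
  simp_rw [this]
  ring

lemma sum_Y_apply {N s h n : ℕ} (hNlb : p.Nlb ∣ N) (j : Fin (p.Ksb + 3)) (x : ℕ → 𝔛) :
    ∑ k ∈ Finset.range p.Nlb, p.Y P₀ N s h n k x j =
      ∑ t ∈ Finset.Ico 0 N, p.X P₀ N s h n t x j := by
  simp only [Y, groupSum_apply]
  rw [sum_range_groupSum, Nat.div_mul_cancel hNlb, Finset.range_eq_Ico]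

namespace WellDefined

variable (hp : p.WellDefined P₀) {N s h : ℕ} (hN : 0 < N) (hh : 0 < h) (hs : p.sMin h ≤ s)
include hp hN hh hs

/-- The expansion of the summing statistic. -/
lemma meanClose_Tsum (hNlb : p.Nlb ∣ N) :
    MeanClose (lawH0 P₀) (fun n x => p.Tsum P₀ n x)
      (fun n x => ∑ k ∈ Finset.range p.Nlb, p.Y P₀ N s h n k x p.idxSum) := by
  have hhs : h ≤ s := (hp.le_sMin h).trans hs
  have hg := hp.isCenteredLocal_centeredSum
  have hσ := hp.sigmaSum_pos
  set σ := sigmaH0 P₀ p.fSum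
  have hα : Tendsto (fun n : ℕ => √(n : ℝ) * ((√((n : ℝ) - p.mSum + 1))⁻¹ * σ⁻¹)) atTop
      (𝓝 σ⁻¹) := by
    have h1 := (tendsto_sqrt_mul_inv_sqrt (m := fun n => (n : ℝ) - p.mSum + 1) (κ := 1) ?_ ?_
      one_pos).mul_const σ⁻¹
    · simpa [mul_assoc] using h1
    · filter_upwards [eventually_ge_atTop p.mSum] with n hn
      have : (p.mSum : ℝ) ≤ n := by exact_mod_cast hn
      linarith
    · refine tendsto_div_of_abs_sub_le (C := p.mSum + 1) (Eventually.of_forall fun n => ?_)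
      have : (0 : ℝ) ≤ p.mSum := Nat.cast_nonneg _
      rw [abs_le]; constructor <;> linarith
  have hlim := hg.tendsto_integral_sq_sub (h := 1) (q := p.mSum) (by omega) hα
    (tendsto_sqrt_mul_div_sqrt σ⁻¹) (a := fun _ => 0) (b := fun n => n)
    (I := fun n => Finset.range (n + 1 - p.mSum))
    (J := fun n => unitIdx s h (n / N) h (Finset.Ico 0 N))
    (C := p.mSum + N * (s + h + 1)) (fun n => le_rfl)
    (fun n i hi => by
      have := hp.mSum_pos
      simp only [Finset.mem_range, Finset.mem_Ico] at hi ⊢; omega)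
    (fun n => by simpa using unitIdx_subset (n := n) hh hhs one_pos (one_mul h))
    (fun n => by rw [Finset.card_range]; omega)
    (fun n => by
      have := le_card_unitIdx_add (n := n) hN hh hhs one_pos (one_mul h)
      simp only [Nat.div_one] at this
      omega)
  refine (meanClose_of_tendsto_integral_sq (fun n => (hg.memLp_shiftSumOn _ _).const_mul _)
    (fun n => (hg.memLp_shiftSumOn _ _).const_mul _) hlim).congr
    (Eventually.of_forall fun n x => ?_) (Eventually.of_forall fun n x => ?_)
  · rw [Tsum, shiftSumOn, div_eq_inv_mul, mul_inv, mul_comm σ⁻¹]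
    congr 1
    refine Finset.sum_congr rfl fun i _ => ?_
    rw [centeredSum, one_mul, ← chain_eq_chain_shift]
  · rw [sum_Y_apply hNlb]
    exact sum_X_apply hh hhs (one_mul h) (hp.centeredVec_idxSum h) _ n x

/-- The expansion of the short-block statistic. The factor `L_sb` appears because there are about
`n / L_sb` short blocks, while the vectors `𝒴` are normalized by `√n`. -/
lemma meanClose_Tsb (hNlb : p.Nlb ∣ N) (hLsb : p.Lsb ∣ h) :
    MeanClose (lawH0 P₀) (fun n x => p.Tsb P₀ n x)
      (fun n x => p.Lsb * ∑ j, (∑ k ∈ Finset.range p.Nlb,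
        p.Y P₀ N s h n k x (p.idxSb j)) ^ 2) := by
  have hhs : h ≤ s := (hp.le_sMin h).trans hs
  have hL := hp.Lsb_pos
  have hL' : (0 : ℝ) < p.Lsb := by exact_mod_cast hL
  have her : p.Lsb * (h / p.Lsb) = h := Nat.mul_div_cancel' hLsb
  have hterm : ∀ j, MeanClose (lawH0 P₀)
      (fun n x => (p.w n j x - p.Nsb n * p.Esb P₀ j) ^ 2 / (p.Nsb n * p.Esb P₀ j))
      (fun n x => p.Lsb * (∑ k ∈ Finset.range p.Nlb, p.Y P₀ N s h n k x (p.idxSb j)) ^ 2) := by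
    intro j
    have hg := hp.isCenteredLocal_centeredSb j
    have hE := hp.Esb_pos j
    set E := p.Esb P₀ j
    have hα : Tendsto (fun n : ℕ => √(n : ℝ) * (√((p.Nsb n : ℝ) * E))⁻¹) atTop
        (𝓝 (√((p.Lsb : ℝ)⁻¹ * E))⁻¹) := by
      refine tendsto_sqrt_mul_inv_sqrt ?_ ?_ (by positivity)
      · filter_upwards [eventually_ge_atTop p.Lsb] with n hn
        have : 0 < p.Nsb n := Nat.div_pos hn hL
        positivity
      · have h1 : Tendsto (fun n : ℕ => (p.Nsb n : ℝ) / n) atTop (𝓝 (p.Lsb : ℝ)⁻¹) :=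
          tendsto_div_of_abs_sub_le (Eventually.of_forall fun n => abs_natDiv_sub_le hL n)
        exact (h1.mul_const E).congr fun n => by ring
    have hβ : Tendsto (fun n : ℕ => √(n : ℝ) * (√p.Lsb * (√E)⁻¹ / √(n : ℝ))) atTop
        (𝓝 (√((p.Lsb : ℝ)⁻¹ * E))⁻¹) := by
      rw [Real.sqrt_mul (by positivity), Real.sqrt_inv, mul_inv, inv_inv]
      exact tendsto_sqrt_mul_div_sqrt _
    have hb : ∀ n, p.Nsb n ≤ n := fun n => Nat.div_le_self n _
    have hlim := hg.tendsto_integral_sq_sub (h := p.Lsb) (q := 0) (by omega) hα hβ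
      (a := fun _ => 0) (b := fun n => p.Nsb n)
      (I := fun n => Finset.Ico 0 (p.Nsb n))
      (J := fun n => unitIdx s h (n / N) (h / p.Lsb) (Finset.Ico 0 N))
      (C := N * (s + h + 1)) hb (fun n => subset_rfl)
      (fun n => unitIdx_subset hh hhs hL her)
      (fun n => by rw [Nat.card_Ico]; omega)
      (fun n => le_card_unitIdx_add hN hh hhs hL her)
    obtain ⟨C, hC⟩ := hg.eventually_integral_sq_le (h := p.Lsb) (q := 0) (by omega) hα
      (fun _ => 0) (fun n => p.Nsb n) hb
    refine (meanClose_sq_of_tendsto_integral_sq (fun n => (hg.memLp_shiftSumOn _ _).const_mul _)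
      (fun n => (hg.memLp_shiftSumOn _ _).const_mul _) hC hlim).congr
      (Eventually.of_forall fun n x => ?_) (Eventually.of_forall fun n x => ?_)
    · rw [mul_pow, inv_pow, Real.sq_sqrt (by positivity), div_eq_inv_mul]
      congr 2
      simp only [w, shiftSumOn, centeredSb, Finset.sum_sub_distrib, Finset.sum_const,
        nsmul_eq_mul, ← Finset.range_eq_Ico, Finset.card_range, ← chain_eq_chain_shift, E]
    · rw [sum_Y_apply hNlb, sum_X_apply hh hhs her (hp.centeredVec_idxSb h j) _ n x,
        mul_div_assoc, mul_assoc (√(p.Lsb : ℝ)), mul_pow (√(p.Lsb : ℝ)), Real.sq_sqrt hL'.le]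
  refine (MeanClose.sum Finset.univ fun j _ => hterm j).congr
    (Eventually.of_forall fun n x => rfl) (Eventually.of_forall fun n x => ?_)
  rw [Finset.mul_sum]

/-- The expansion of the long-block statistic. The `k`-th long block and the `k`-th group of blocks
start and end at slightly different places, so both are compared within the interval from the
beginning of the group to the end of the long block. -/
lemma meanClose_Tlb (hNlb : p.Nlb ∣ N) :
    MeanClose (lawH0 P₀) (fun n x => p.Tlb P₀ n x)
      (fun n x => p.Nlb * ∑ k ∈ Finset.range p.Nlb, (p.Y P₀ N s h n k x p.idxLb) ^ 2) := by
  have hhs : h ≤ s := (hp.le_sMin h).trans hs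
  have hB := hp.Nlb_pos
  have hB' : (0 : ℝ) < p.Nlb := by exact_mod_cast hB
  have hg := hp.isCenteredLocal_centeredLb
  have hσ := hp.sigmaLb_pos
  set σ := sigmaH0 P₀ p.fLb
  set G := N / p.Nlb with hGdef
  have hG : 0 < G := Nat.div_pos (Nat.le_of_dvd hN hNlb) hB
  have hGN : p.Nlb * G = N := Nat.mul_div_cancel' hNlb
  have hdiv : ∀ n, n / N = p.Llb n / G := fun n => by
    rw [Llb, Nat.div_div_eq_div_mul, hGN]
  have hα : Tendsto (fun n : ℕ => √(n : ℝ) * ((√(p.Llb n))⁻¹ * σ⁻¹)) atTop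
      (𝓝 (√p.Nlb * σ⁻¹)) := by
    have h1 := (tendsto_sqrt_mul_inv_sqrt (m := fun n => (p.Llb n : ℝ)) (κ := (p.Nlb : ℝ)⁻¹) ?_
      (tendsto_div_of_abs_sub_le (Eventually.of_forall fun n => abs_natDiv_sub_le hB n))
      (by positivity)).mul_const σ⁻¹
    · simpa [mul_assoc] using h1
    · filter_upwards [eventually_ge_atTop p.Nlb] with n hn
      exact_mod_cast Nat.div_pos hn hB
  have hterm : ∀ k ∈ Finset.range p.Nlb, MeanClose (lawH0 P₀)
      (fun n x => (p.W n k x - ((p.Llb n : ℝ) - p.mLb + 1) * meanH0 P₀ p.fLb) ^ 2 /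
        (p.Llb n * σ ^ 2))
      (fun n x => p.Nlb * (p.Y P₀ N s h n k x p.idxLb) ^ 2) := by
    intro k hk
    have hk' : k + 1 ≤ p.Nlb := Finset.mem_range.1 hk
    have hb : ∀ n, p.Llb n * (k + 1) ≤ n := fun n =>
      (Nat.mul_le_mul_left _ hk').trans (Nat.div_mul_le_self n _)
    have hLG : ∀ n, n / N * G ≤ p.Llb n := fun n => by
      rw [hdiv]; exact Nat.div_mul_le_self _ _
    have hI : ∀ n, p.Llb n * (k + 1) = p.Llb n * k + p.Llb n := fun n => by ring
    have hcard : ∀ n, p.Llb n * (k + 1) - n / N * (G * k) ≤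
        (unitIdx s h (n / N) h (Finset.Ico (G * k) (G * k + G))).card + G * (k + s + h + 1) :=
      fun n => le_card_unitIdx_group_add hh hhs hG _ (hdiv n)
    have hleft : ∀ n, n / N * (G * k) ≤ p.Llb n * k := fun n => by
      rw [← mul_assoc]; exact Nat.mul_le_mul_right k (hLG n)
    have hright : ∀ n, n / N * (G * k + G) ≤ p.Llb n * (k + 1) := fun n => by
      rw [← Nat.mul_succ, ← mul_assoc]; exact Nat.mul_le_mul_right _ (hLG n)
    have hstart : ∀ n, p.Llb n * k ≤ n / N * (G * k) + G * (k + s + h + 1) := fun n => by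
      have h1 : p.Llb n ≤ G * (n / N + 1) := by
        rw [hdiv]; exact (Nat.lt_mul_div_succ _ hG).le
      have h2 := Nat.mul_le_mul_right k h1
      have e1 : G * (n / N + 1) * k = n / N * (G * k) + G * k := by ring
      have e3 : G * (k + s + h + 1) = G * k + G * (s + h + 1) := by ring
      omega
    have hβ := tendsto_sqrt_mul_div_sqrt (√p.Nlb * σ⁻¹)
    have hlim := hg.tendsto_integral_sq_sub (h := 1) (q := p.mLb) (by omega) hα hβ
      (a := fun n => n / N * (G * k)) (b := fun n => p.Llb n * (k + 1))
      (I := fun n => Finset.Ico (p.Llb n * k) (p.Llb n * (k + 1) + 1 - p.mLb))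
      (J := fun n => unitIdx s h (n / N) h (Finset.Ico (G * k) (G * k + G)))
      (C := G * (k + s + h + 1) + p.mLb) hb
      (fun n i hi => by
        have := hp.mLb_pos
        have := hleft n
        simp only [Finset.mem_Ico] at hi ⊢; omega)
      (fun n i hi => by
        have h1 := bounds_of_mem_unitIdx hh hhs (one_mul h) hi
        have := hright n
        simp only [Finset.mem_Ico]; omega)
      (fun n => by
        have := hstart n
        rw [Nat.card_Ico]; omega)
      (fun n => (hcard n).trans (by omega))
    obtain ⟨C, hC⟩ := hg.eventually_integral_sq_le (h := 1) (q := p.mLb) (by omega) hα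
      (fun n => p.Llb n * k) (fun n => p.Llb n * (k + 1) + 1 - p.mLb)
      (fun n => (by have := hp.mLb_pos; omega : _ ≤ p.Llb n * (k + 1)).trans (hb n))
    refine (meanClose_sq_of_tendsto_integral_sq (fun n => (hg.memLp_shiftSumOn _ _).const_mul _)
      (fun n => (hg.memLp_shiftSumOn _ _).const_mul _) hC hlim).congr
      ?_ (Eventually.of_forall fun n x => ?_)
    · have hLtop : Tendsto p.Llb atTop atTop := Nat.tendsto_div_const_atTop hB.ne'
      filter_upwards [hLtop.eventually_ge_atTop p.mLb] with n hn x
      rw [mul_pow, mul_pow, inv_pow, inv_pow, Real.sq_sqrt (Nat.cast_nonneg _), ← mul_inv,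
        div_eq_inv_mul]
      congr 2
      -- the number of summands in a long block is `L_lb - m_lb + 1`, without truncation
      have hc : ((p.Llb n * (k + 1) + 1 - p.mLb - p.Llb n * k : ℕ) : ℝ) =
          (p.Llb n : ℝ) - p.mLb + 1 := by
        have : p.Llb n * (k + 1) + 1 - p.mLb - p.Llb n * k = p.Llb n - p.mLb + 1 := by
          rw [hI]; omega
        rw [this, Nat.cast_add, Nat.cast_sub hn, Nat.cast_one]
      simp only [W, shiftSumOn, centeredLb, Finset.sum_sub_distrib, Finset.sum_const,
        nsmul_eq_mul, Nat.card_Ico, hc, one_mul, ← chain_eq_chain_shift]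
    · rw [Y, groupSum_apply, groupSum_eq_sum_Ico,
        sum_X_apply hh hhs (one_mul h) (hp.centeredVec_idxLb h) _ n x,
        mul_div_assoc, mul_assoc (√(p.Nlb : ℝ)), mul_pow (√(p.Nlb : ℝ)), Real.sq_sqrt hB'.le]
  refine (MeanClose.sum (Finset.range p.Nlb) hterm).congr
    (Eventually.of_forall fun n x => ?_) (Eventually.of_forall fun n x => ?_)
  · rw [Tlb, Finset.sum_div]
  · rw [Finset.mul_sum]

end WellDefined

end StatParams

/-! ### Measurability and locality of the statistics -/

lemma dependsOn_chain {𝔛 : Type*} {m j n : ℕ} (h : j + m ≤ n) :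
    DependsOn (chain m j : (ℕ → 𝔛) → Fin m → 𝔛) (Set.Iio n) := by
  intro x y hxy
  ext i
  exact hxy (j + i) (by have := i.2; simp only [Set.mem_Iio]; omega)

namespace StatParams

variable {𝔛 : Type*} [MeasurableSpace 𝔛] {p : StatParams 𝔛}
  {P₀ : Measure 𝔛} [IsProbabilityMeasure P₀]

lemma dependsOn_Tsum (n : ℕ) : DependsOn (p.Tsum P₀ n) (Set.Iio n) := by
  intro x y hxy
  have h : ∀ i ∈ Finset.range (n + 1 - p.mSum), chain p.mSum i x = chain p.mSum i y :=
    fun i hi => dependsOn_chain (by have := Finset.mem_range.1 hi; omega) hxy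
  simp only [Tsum]
  rw [Finset.sum_congr rfl fun i hi => by rw [h i hi]]

lemma dependsOn_Tlb (n : ℕ) : DependsOn (p.Tlb P₀ n) (Set.Iio n) := by
  intro x y hxy
  have h : ∀ k ∈ Finset.range p.Nlb, p.W n k x = p.W n k y := by
    intro k hk
    refine Finset.sum_congr rfl fun i hi => ?_
    have h1 : p.Llb n * (k + 1) ≤ n :=
      (Nat.mul_le_mul_left _ (Finset.mem_range.1 hk)).trans (Nat.div_mul_le_self n _)
    rw [dependsOn_chain (by have := (Finset.mem_Ico.1 hi).2; omega) hxy]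
  simp only [Tlb]
  rw [Finset.sum_congr rfl fun k hk => by rw [h k hk]]

lemma dependsOn_Tsb (n : ℕ) : DependsOn (p.Tsb P₀ n) (Set.Iio n) := by
  intro x y hxy
  have h : ∀ j, p.w n j x = p.w n j y := by
    intro j
    refine Finset.sum_congr rfl fun i hi => ?_
    have h1 : p.Lsb * (i + 1) ≤ n :=
      (Nat.mul_le_mul_left _ (Finset.mem_range.1 hi)).trans (Nat.mul_div_le n _)
    rw [mul_add, mul_one] at h1
    rw [dependsOn_chain h1 hxy]
  simp only [Tsb, h]

namespace WellDefined

variable (hp : p.WellDefined P₀)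
include hp

lemma measurable_Tsum (n : ℕ) : Measurable (p.Tsum P₀ n) := by
  have h : ∀ i, Measurable fun x => p.fSum (chain p.mSum i x) := fun i =>
    hp.measurable_fSum.comp (measurable_chain _ _)
  exact (Finset.measurable_fun_sum _ fun i _ => (h i).sub_const _).div_const _

lemma measurable_Tlb (n : ℕ) : Measurable (p.Tlb P₀ n) := by
  have h : ∀ i, Measurable fun x => p.fLb (chain p.mLb i x) := fun i =>
    hp.measurable_fLb.comp (measurable_chain _ _)
  have hW : ∀ k, Measurable (p.W n k) := fun k => Finset.measurable_fun_sum _ fun i _ => h i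
  exact (Finset.measurable_fun_sum _ fun k _ => ((hW k).sub_const _).pow_const 2).div_const _

lemma measurable_Tsb (n : ℕ) : Measurable (p.Tsb P₀ n) := by
  have h : ∀ i j, Measurable fun x =>
      (p.αSb j).indicator (1 : ℝ → ℝ) (p.fSb (chain p.Lsb i x)) := by
    intro i j
    have h1 := (((hp.isCenteredLocal_centeredSb j).measurable.comp
      (measurable_shift i)).add_const (p.Esb P₀ j))
    have e : (fun x => (p.αSb j).indicator (1 : ℝ → ℝ) (p.fSb (chain p.Lsb i x))) =
        fun x => (p.centeredSb P₀ j ∘ shift i) x + p.Esb P₀ j := by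
      ext x
      simp [centeredSb, ← chain_eq_chain_shift]
    rw [e]
    exact h1
  have hw : ∀ j, Measurable (p.w n j) := fun j => Finset.measurable_fun_sum _ fun i _ => h _ j
  exact Finset.measurable_fun_sum _ fun j _ => (((hw j).sub_const _).pow_const 2).div_const _

lemma measurable_Y (N s h n k : ℕ) : Measurable (p.Y P₀ N s h n k) := by
  have h1 : Measurable fun x => ∑ i ∈ Finset.range (N / p.Nlb),
      p.X P₀ N s h n (N / p.Nlb * k + i) x :=
    Finset.measurable_fun_sum _ fun _ _ => hp.measurable_X N s h n _
  exact h1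

lemma measurable_Y_apply (N s h n k : ℕ) (j : Fin (p.Ksb + 3)) :
    Measurable fun x => p.Y P₀ N s h n k x j :=
  (EuclideanSpace.proj (𝕜 := ℝ) j).continuous.measurable.comp (hp.measurable_Y N s h n k)

lemma dependsOn_Y {N s h : ℕ} (hh : 0 < h) (hs : p.sMin h ≤ s) (n : ℕ)
    {k : ℕ} (hk : k < p.Nlb) : DependsOn (p.Y P₀ N s h n k) (Set.Iio n) := by
  change DependsOn (fun x => ∑ i ∈ Finset.range (N / p.Nlb),
    p.X P₀ N s h n (N / p.Nlb * k + i) x) _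
  refine dependsOn_finset_sum _ fun i hi => (hp.dependsOn_X hh hs n _).mono fun t ht => ?_
  have h1 : N / p.Nlb * (k + 1) ≤ N :=
    (Nat.mul_le_mul_left _ hk).trans (Nat.div_mul_le_self N _)
  have h2 : N / p.Nlb * k + i + 1 ≤ N := by
    have := Finset.mem_range.1 hi
    rw [mul_add, mul_one] at h1
    omega
  have h3 := (Nat.mul_le_mul_left (n / N) h2).trans (Nat.div_mul_le_self n N)
  simp only [Finset.coe_Ico, Set.mem_Ico, Set.mem_Iio] at ht ⊢
  omega

end WellDefined

end StatParams

/-! ### Transfer to the tested elements -/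

namespace HypothesisH0

variable {𝔛 : Type*} [MeasurableSpace 𝔛] {P₀ : Measure 𝔛} [IsProbabilityMeasure P₀]
  {Ω : ℕ → Type*} [∀ n, MeasurableSpace (Ω n)] {P : ∀ n, Measure (Ω n)}
  {ε : ∀ n, ℕ → Ω n → 𝔛} (hε : HypothesisH0 P₀ P ε)
include hε

/-- A function of the first `n` elements has the same law for the `n`-th series and for the
infinite sequence. -/
lemma hasLaw_comp {E : Type*} [MeasurableSpace E] {F : (ℕ → 𝔛) → E} (hF : Measurable F) {n : ℕ}
    (hdep : DependsOn F (Set.Iio n)) :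
    HasLaw (fun ω => F fun i => ε n i ω) ((lawH0 P₀).map F) (P n) := by
  have : Nonempty 𝔛 := nonempty_of_isProbabilityMeasure P₀
  have hdep' : DependsOn F (Finset.range n : Finset ℕ) := hdep.mono fun t ht => by simpa using ht
  obtain ⟨G, hG, hFG⟩ := hdep'.exists_measurable_comp hF
  have hlt : ∀ i : Finset.range n, (i : ℕ) < n := fun i => Finset.mem_range.1 i.2
  have hind : iIndepFun (fun (i : Finset.range n) => ε n i) (P n) :=
    (hε.indep n).precomp (g := fun i : Finset.range n => (⟨i, hlt i⟩ : Fin n))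
      fun i j hij => Subtype.ext (by simpa using hij)
  have hlaw : HasLaw (fun ω (i : Finset.range n) => ε n i ω) (Measure.pi fun _ => P₀) (P n) :=
    iIndepFun.hasLaw_pi (X := fun i : Finset.range n => ε n i) (μ := fun _ => P₀)
      (fun i => hε.hasLaw n i (hlt i)) hind
  have hrestr : HasLaw (fun (x : ℕ → 𝔛) (i : Finset.range n) => x i) (Measure.pi fun _ => P₀)
      (lawH0 P₀) :=
    ⟨(measurable_pi_lambda _ fun i => measurable_pi_apply _).aemeasurable,
      Measure.infinitePi_map_restrict (fun _ : ℕ => P₀)⟩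
  have e : (lawH0 P₀).map F = (Measure.pi fun _ => P₀).map G := by
    rw [← hrestr.map_eq, Measure.map_map hG (by fun_prop)]
    exact congrArg (fun F' => (lawH0 P₀).map F') (funext hFG)
  have hGlaw : HasLaw G ((lawH0 P₀).map F) (Measure.pi fun _ => P₀) := ⟨hG.aemeasurable, e.symm⟩
  refine HasLaw.congr (X := G ∘ fun ω (i : Finset.range n) => ε n i ω) (hGlaw.comp hlaw) ?_
  exact ae_of_all _ fun ω => hFG _

/-- Convergence in distribution under the law of the infinite sequence carries over to the series
scheme. -/
lemma tendstoInDistribution [∀ n, IsProbabilityMeasure (P n)] {E : Type*} [TopologicalSpace E]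
    [MeasurableSpace E] [OpensMeasurableSpace E] {F : ℕ → (ℕ → 𝔛) → E}
    (hF : ∀ n, Measurable (F n)) (hdep : ∀ n, DependsOn (F n) (Set.Iio n))
    {Ω' : Type*} [MeasurableSpace Ω'] {P' : Measure Ω'} [IsProbabilityMeasure P'] {Z : Ω' → E}
    (h : TendstoInDistribution F atTop Z (fun _ => lawH0 P₀) P') :
    TendstoInDistribution (fun n ω => F n fun i => ε n i ω) atTop Z P P' where
  forall_aemeasurable n := (hε.hasLaw_comp (hF n) (hdep n)).aemeasurable
  aemeasurable_limit := h.aemeasurable_limit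
  tendsto := h.tendsto.congr fun n =>
    Subtype.ext (hε.hasLaw_comp (hF n) (hdep n)).map_eq.symm

/-- Closeness in mean under the law of the infinite sequence gives equality up to a term vanishing
in probability for the series scheme. -/
lemma eqUpToSmallP {A B : ℕ → (ℕ → 𝔛) → ℝ} (hAB : MeanClose (lawH0 P₀) A B)
    (hA : ∀ n, Measurable (A n)) (hB : ∀ n, Measurable (B n))
    (hdA : ∀ n, DependsOn (A n) (Set.Iio n)) (hdB : ∀ n, DependsOn (B n) (Set.Iio n)) :
    EqUpToSmallP P (fun n ω => A n fun i => ε n i ω) (fun n ω => B n fun i => ε n i ω) := by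
  intro δ hδ
  have h1 := tendsto_measure_le_of_tendsto_integral (f := fun n x => |A n x - B n x|)
    (fun _ _ => abs_nonneg _) (hAB.1.mono fun n hn => hn.abs) hAB.2 hδ
  refine h1.congr fun n => ?_
  have hm : Measurable fun x => |A n x - B n x| :=
    continuous_abs.measurable.comp ((hA n).sub (hB n))
  have hd : DependsOn (fun x => |A n x - B n x|) (Set.Iio n) := fun x y hxy => by
    simp only [hdA n hxy, hdB n hxy]
  have hlaw := hε.hasLaw_comp hm hd
  have hms : MeasurableSet {r : ℝ | δ ≤ r} := measurableSet_Ici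
  rw [hlaw.measure_eq (p := fun r => δ ≤ r) hms, Measure.map_apply hm hms]
  rfl

end HypothesisH0

/-! ### The limit vectors -/

section GroupSums

variable {Ω' : Type*} [MeasurableSpace Ω'] {P' : Measure Ω'} {d N M : ℕ}
  {η ζ : ℕ → Ω' → EuclideanSpace ℝ (Fin d)}

/-- The place among `0, …, N - 1` of the `i`-th member of the `k`-th group. -/
def groupIdx (N : ℕ) {M k : ℕ} (hk : k < M) (i : Fin (N / M)) : Fin N :=
  ⟨N / M * k + i, by
    have h1 := (Nat.mul_le_mul_left (N / M) hk).trans (Nat.div_mul_le_self N M)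
    have h2 := i.2
    rw [Nat.mul_succ] at h1
    omega⟩

lemma groupSum_eq_sum_groupIdx {E : Type*} [AddCommMonoid E] {k : ℕ} (hk : k < M) (v : ℕ → E) :
    groupSum N M v k = ∑ i : Fin (N / M), v (groupIdx N hk i) := by
  rw [groupSum, Finset.sum_range]
  rfl

lemma groupIdx_injective {k : ℕ} (hk : k < M) : Function.Injective (groupIdx N hk) := by
  intro i j hij
  have := congrArg Fin.val hij
  simp only [groupIdx] at this
  exact Fin.ext (by omega)

lemma iIndepFun_groupSum (hη : iIndepFun (fun k : Fin N => η k) P')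
    (hm : ∀ k < N, AEMeasurable (η k) P')
    (hζ : ∀ k < M, ∀ ω, ζ k ω = groupSum N M (fun t => η t ω) k) :
    iIndepFun (fun k : Fin M => ζ k) P' := by
  classical
  set S : Fin M → Finset (Fin N) := fun k => Finset.univ.image (groupIdx N k.2)
  have hmem : ∀ k i, groupIdx N k.2 i ∈ S k := fun k i =>
    Finset.mem_image_of_mem _ (Finset.mem_univ _)
  have hdisj : Pairwise fun k l => Disjoint (S k) (S l) := by
    intro k l hkl
    wlog hlt : (k : ℕ) < l generalizing k l
    · exact (this hkl.symm (by have := Fin.val_ne_of_ne hkl; omega)).symm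
    refine Finset.disjoint_left.2 fun a ha ha' => ?_
    simp only [S, Finset.mem_image, Finset.mem_univ, true_and] at ha ha'
    obtain ⟨i, rfl⟩ := ha
    obtain ⟨j, hj⟩ := ha'
    have h1 := congrArg Fin.val hj
    simp only [groupIdx] at h1
    have h2 := Nat.mul_le_mul_left (N / M) hlt
    have h3 := i.2
    rw [Nat.mul_succ] at h2
    omega
  have h := hη.comp_finsets (fun k => hm k k.2) hdisj
    (G := fun k y => ∑ i : Fin (N / M), y ⟨groupIdx N k.2 i, hmem k i⟩)
    (fun k => Finset.measurable_fun_sum _ fun i _ => measurable_pi_apply _)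
  convert! h using 1
  ext1 k
  ext1 ω
  rw [hζ k k.2, groupSum_eq_sum_groupIdx k.2]

/-- The sum of the Gaussian vectors of a group, by the product formula for characteristic
functions. -/
lemma hasLaw_groupSum [IsProbabilityMeasure P'] {V : Matrix (Fin d) (Fin d) ℝ} (hV : V.PosSemidef)
    (hη : iIndepFun (fun k : Fin N => η k) P') {c : ℝ} (hc : 0 ≤ c)
    (hlaw : ∀ k < N, HasLaw (η k) (multivariateGaussian 0 (c • V)) P') {k : ℕ} (hk : k < M)
    (hζ : ∀ ω, ζ k ω = groupSum N M (fun t => η t ω) k) :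
    HasLaw (ζ k) (multivariateGaussian 0 (((N / M : ℕ) * c) • V)) P' := by
  have he : ζ k = fun ω => ∑ i : Fin (N / M), η (groupIdx N hk i) ω := by
    ext1 ω
    rw [hζ, groupSum_eq_sum_groupIdx hk]
  have hl : ∀ i : Fin (N / M), HasLaw (η (groupIdx N hk i)) (multivariateGaussian 0 (c • V)) P' :=
    fun i => hlaw _ (groupIdx N hk i).2
  have hm : AEMeasurable (ζ k) P' := by
    rw [he]
    exact Finset.aemeasurable_fun_sum _ fun i _ => (hl i).aemeasurable
  refine ⟨hm, ?_⟩
  have := Measure.isProbabilityMeasure_map (μ := P') hm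
  refine Measure.ext_of_charFun ?_
  have hind : iIndepFun (fun i : Fin (N / M) => η (groupIdx N hk i)) P' :=
    hη.precomp (groupIdx_injective hk)
  rw [he, hind.charFun_map_fun_sum_eq_prod fun i => (hl i).aemeasurable]
  ext t
  rw [Finset.prod_apply]
  simp_rw [(hl _).map_eq, charFun_multivariateGaussian (hV.smul hc)]
  rw [charFun_multivariateGaussian (hV.smul (by positivity)), ← Complex.exp_sum]
  congr 1
  simp [Matrix.smul_mulVec]
  ring

end GroupSums

/-! ### Convergence in distribution -/

namespace StatParams.WellDefined

variable {𝔛 : Type*} [MeasurableSpace 𝔛] {p : StatParams 𝔛}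
  {P₀ : Measure 𝔛} [IsProbabilityMeasure P₀] (hp : p.WellDefined P₀)
  {N s h : ℕ} (hN : 0 < N) (hh : 0 < h) (hs : p.sMin h ≤ s) (hNlb : p.Nlb ∣ N)
  {Ω' : Type*} [MeasurableSpace Ω'] {P' : Measure Ω'} [IsProbabilityMeasure P']
  {η ζ : ℕ → Ω' → EuclideanSpace ℝ (Fin (p.Ksb + 3))}
include hp hN hh hs

/-- The group sums `𝒴` are a continuous function of the block sums `𝒳`. -/
lemma tendstoInDistribution_Y (hη_indep : iIndepFun (fun k : Fin N => η k) P')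
    (hη_law : ∀ k < N,
      HasLaw (η k) (multivariateGaussian 0 ((1 / ((N : ℝ) * h)) • p.Φ P₀ s h)) P')
    (hζ : ∀ k < p.Nlb, ∀ ω, ζ k ω = groupSum N p.Nlb (fun t => η t ω) k) :
    TendstoInDistribution (fun n x => fun k : Fin p.Nlb => p.Y P₀ N s h n k x) atTop
      (fun ω => fun k : Fin p.Nlb => ζ k ω) (fun _ => lawH0 P₀) P' := by
  set G : (Fin N → EuclideanSpace ℝ (Fin (p.Ksb + 3))) →
      Fin p.Nlb → EuclideanSpace ℝ (Fin (p.Ksb + 3)) :=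
    fun v k => ∑ i : Fin (N / p.Nlb), v (groupIdx N k.2 i) with hG
  have hGc : Continuous G := by
    rw [hG]; fun_prop
  have h1 := (hp.tendstoInDistribution_X hN hh hs hη_indep hη_law).continuous_comp hGc
  convert! h1 using 1
  · ext1 n
    ext1 x
    ext1 k
    rw [Y, groupSum_eq_sum_groupIdx k.2]
    rfl
  · ext1 ω
    ext1 k
    rw [hζ k k.2, groupSum_eq_sum_groupIdx k.2]
    rfl

include hNlb in
/-- The three statistics differ by a term vanishing in probability from a continuous function of the
group sums. -/
lemma tendstoInDistribution_statistics (hLsb : p.Lsb ∣ h)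
    (hY : TendstoInDistribution (fun n x => fun k : Fin p.Nlb => p.Y P₀ N s h n k x) atTop
      (fun ω => fun k : Fin p.Nlb => ζ k ω) (fun _ => lawH0 P₀) P') :
    TendstoInDistribution (fun n x => (p.Tsum P₀ n x, p.Tlb P₀ n x, p.Tsb P₀ n x)) atTop
      (fun ω => (∑ k ∈ Finset.range p.Nlb, ζ k ω p.idxSum,
        (p.Nlb : ℝ) * ∑ k ∈ Finset.range p.Nlb, (ζ k ω p.idxLb) ^ 2,
        (p.Lsb : ℝ) * ∑ j, (∑ k ∈ Finset.range p.Nlb, ζ k ω (p.idxSb j)) ^ 2))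
      (fun _ => lawH0 P₀) P' := by
  set G : (Fin p.Nlb → EuclideanSpace ℝ (Fin (p.Ksb + 3))) → ℝ × ℝ × ℝ := fun y =>
    (∑ k, y k p.idxSum, (p.Nlb : ℝ) * ∑ k, (y k p.idxLb) ^ 2,
      (p.Lsb : ℝ) * ∑ j, (∑ k, y k (p.idxSb j)) ^ 2) with hG
  have hGc : Continuous G := by
    rw [hG]; fun_prop
  have h1 := hY.continuous_comp hGc
  have hc1 := hp.meanClose_Tsum hN hh hs hNlb
  have hc2 := hp.meanClose_Tlb hN hh hs hNlb
  have hc3 := hp.meanClose_Tsb hN hh hs hNlb hLsb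
  have hlim := (hc1.2.add hc2.2).add hc3.2
  simp only [add_zero] at hlim
  have h2 := tendstoInDistribution_of_tendstoInMeasure_sub
    (Y := fun n x => (p.Tsum P₀ n x, p.Tlb P₀ n x, p.Tsb P₀ n x)) _ h1 ?_ fun n =>
      ((hp.measurable_Tsum n).prodMk
        ((hp.measurable_Tlb n).prodMk (hp.measurable_Tsb n))).aemeasurable
  · convert! h2 using 1
    ext1 ω
    simp only [Finset.sum_range]
    rfl
  · rw [tendstoInMeasure_iff_norm]
    intro δ hδ
    have hint := (hc1.1.and (hc2.1.and hc3.1)).mono fun n hn =>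
      (hn.1.abs.add hn.2.1.abs).add hn.2.2.abs
    refine tendsto_of_tendsto_of_tendsto_of_le_of_le tendsto_const_nhds
      (tendsto_measure_le_of_tendsto_integral (fun n x => ?_) hint (hlim.congr' ?_) hδ)
      (fun _ => zero_le) fun n => measure_mono fun x hx => ?_
    · simp only [Pi.add_apply]
      positivity
    · filter_upwards [hc1.1, hc2.1, hc3.1] with n i1 i2 i3
      rw [integral_add' (i1.abs.add i2.abs) i3.abs, integral_add' i1.abs i2.abs]
    · refine le_trans (b := ‖_‖) hx ?_
      have hnorm : ∀ a b c : ℝ, ‖(a, b, c)‖ ≤ |a| + |b| + |c| := fun a b c => by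
        simp only [Prod.norm_def, Real.norm_eq_abs, sup_le_iff]
        have := abs_nonneg a
        have := abs_nonneg b
        have := abs_nonneg c
        refine ⟨?_, ?_, ?_⟩ <;> linarith
      refine le_trans (le_of_eq ?_) (hnorm _ _ _)
      simp only [hG, Finset.sum_range]
      simp

end StatParams.WellDefined

theorem corollary1 {𝔛 : Type*} [MeasurableSpace 𝔛] (P₀ : Measure 𝔛) [IsProbabilityMeasure P₀]
    (p : StatParams 𝔛) (hp : p.WellDefined P₀)
    (N s h : ℕ) (hN : 0 < N) (hh : 0 < h) (hs : p.sMin h ≤ s)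
    (hNlb : p.Nlb ∣ N) (hLsb : p.Lsb ∣ h)
    {Ω : ℕ → Type*} [∀ n, MeasurableSpace (Ω n)] (P : ∀ n, Measure (Ω n))
    [∀ n, IsProbabilityMeasure (P n)]
    (ε : ∀ n, ℕ → Ω n → 𝔛) (hε : HypothesisH0 P₀ P ε)
    {Ω' : Type*} [MeasurableSpace Ω'] (P' : Measure Ω') [IsProbabilityMeasure P']
    (η ζ : ℕ → Ω' → EuclideanSpace ℝ (Fin (p.Ksb + 3)))
    (hη_indep : iIndepFun (fun k : Fin N => η k) P')
    (hη_law : ∀ k < N,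
      HasLaw (η k) (multivariateGaussian 0 ((1 / ((N : ℝ) * h)) • p.Φ P₀ s h)) P')
    (hζ : ∀ k < p.Nlb, ∀ ω, ζ k ω = groupSum N p.Nlb (fun t => η t ω) k) :
    -- the covariance matrix is a genuine one
    (p.Φ P₀ s h).PosSemidef ∧
    -- the law of `ζ₁, …, ζ_{N_lb}`
    iIndepFun (fun k : Fin p.Nlb => ζ k) P' ∧
    (∀ k < p.Nlb,
      HasLaw (ζ k) (multivariateGaussian 0 ((1 / ((h : ℝ) * p.Nlb)) • p.Φ P₀ s h)) P') ∧
    -- the expansions of the three statistics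
    EqUpToSmallP P (fun n ω => p.Tsum P₀ n fun i => ε n i ω)
      (fun n ω => ∑ k ∈ Finset.range p.Nlb, p.Y P₀ N s h n k (fun i => ε n i ω) p.idxSum) ∧
    EqUpToSmallP P (fun n ω => p.Tlb P₀ n fun i => ε n i ω)
      (fun n ω => p.Nlb * ∑ k ∈ Finset.range p.Nlb,
        (p.Y P₀ N s h n k (fun i => ε n i ω) p.idxLb) ^ 2) ∧
    EqUpToSmallP P (fun n ω => p.Tsb P₀ n fun i => ε n i ω)
      (fun n ω => p.Lsb * ∑ j, (∑ k ∈ Finset.range p.Nlb,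
        p.Y P₀ N s h n k (fun i => ε n i ω) (p.idxSb j)) ^ 2) ∧
    -- the limit law of `(𝒴₁, …, 𝒴_{N_lb})`
    TendstoInDistribution
      (fun n ω => fun k : Fin p.Nlb => p.Y P₀ N s h n k fun i => ε n i ω) atTop
      (fun ω => fun k : Fin p.Nlb => ζ k ω) P P' ∧
    -- the limit law of the three statistics
    TendstoInDistribution
      (fun n ω => (p.Tsum P₀ n (fun i => ε n i ω), p.Tlb P₀ n (fun i => ε n i ω),
        p.Tsb P₀ n (fun i => ε n i ω))) atTop
      (fun ω => (∑ k ∈ Finset.range p.Nlb, ζ k ω p.idxSum,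
        (p.Nlb : ℝ) * ∑ k ∈ Finset.range p.Nlb, (ζ k ω p.idxLb) ^ 2,
        (p.Lsb : ℝ) * ∑ j, (∑ k ∈ Finset.range p.Nlb, ζ k ω (p.idxSb j)) ^ 2)) P P' := by
  have hΦ := hp.posSemidef_Φ hh hs
  have hYdep : ∀ n, ∀ k ∈ Finset.range p.Nlb, DependsOn (p.Y P₀ N s h n k) (Set.Iio n) :=
    fun n k hk => hp.dependsOn_Y hh hs n (Finset.mem_range.1 hk)
  have hYm := hp.measurable_Y_apply N s h
  have hY := hp.tendstoInDistribution_Y hN hh hs hη_indep hη_law hζ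
  refine ⟨hΦ, iIndepFun_groupSum hη_indep (fun k hk => (hη_law k hk).aemeasurable) hζ,
    fun k hk => ?_, ?_, ?_, ?_, ?_, ?_⟩
  · have h1 := hasLaw_groupSum hΦ hη_indep (by positivity) hη_law hk (hζ k hk)
    have hB : (p.Nlb : ℝ) ≠ 0 := by exact_mod_cast hp.Nlb_pos.ne'
    have hN' : (N : ℝ) ≠ 0 := by exact_mod_cast hN.ne'
    have e : ((N / p.Nlb : ℕ) : ℝ) * (1 / ((N : ℝ) * h)) = 1 / ((h : ℝ) * p.Nlb) := by
      rw [Nat.cast_div hNlb hB]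
      field_simp
    rwa [e] at h1
  · exact hε.eqUpToSmallP (A := p.Tsum P₀)
      (B := fun n x => ∑ k ∈ Finset.range p.Nlb, p.Y P₀ N s h n k x p.idxSum)
      (hp.meanClose_Tsum hN hh hs hNlb) hp.measurable_Tsum
      (fun n => Finset.measurable_fun_sum _ fun k _ => hYm n k _) StatParams.dependsOn_Tsum
      fun n x y hxy => Finset.sum_congr rfl fun k hk => by rw [hYdep n k hk hxy]
  · exact hε.eqUpToSmallP (A := p.Tlb P₀)
      (B := fun n x => p.Nlb * ∑ k ∈ Finset.range p.Nlb, (p.Y P₀ N s h n k x p.idxLb) ^ 2)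
      (hp.meanClose_Tlb hN hh hs hNlb) hp.measurable_Tlb
      (fun n => (Finset.measurable_fun_sum _ fun k _ => (hYm n k _).pow_const 2).const_mul _)
      StatParams.dependsOn_Tlb fun n x y hxy => congrArg ((p.Nlb : ℝ) * ·)
        (Finset.sum_congr rfl fun k hk => by rw [hYdep n k hk hxy])
  · have hm : ∀ j, ∀ n, Measurable fun x => ∑ k ∈ Finset.range p.Nlb,
        p.Y P₀ N s h n k x (p.idxSb j) :=
      fun j n => Finset.measurable_fun_sum _ fun k _ => hYm n k _
    have hd : ∀ j, ∀ n, DependsOn (fun x => ∑ k ∈ Finset.range p.Nlb,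
        p.Y P₀ N s h n k x (p.idxSb j)) (Set.Iio n) :=
      fun j n x y hxy => Finset.sum_congr rfl fun k hk => by rw [hYdep n k hk hxy]
    exact hε.eqUpToSmallP (A := p.Tsb P₀)
      (B := fun n x => p.Lsb * ∑ j, (∑ k ∈ Finset.range p.Nlb,
        p.Y P₀ N s h n k x (p.idxSb j)) ^ 2)
      (hp.meanClose_Tsb hN hh hs hNlb hLsb) hp.measurable_Tsb
      (fun n => (Finset.measurable_fun_sum _ fun j _ => (hm j n).pow_const 2).const_mul _)
      StatParams.dependsOn_Tsb fun n x y hxy => congrArg ((p.Lsb : ℝ) * ·)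
        (Finset.sum_congr rfl fun j _ => congrArg (· ^ 2) (hd j n hxy))
  · exact hε.tendstoInDistribution
      (F := fun n x => fun k : Fin p.Nlb => p.Y P₀ N s h n k x)
      (fun n => measurable_pi_lambda _ fun k => hp.measurable_Y N s h n k)
      (fun n x y hxy => funext fun k => hp.dependsOn_Y hh hs n k.2 hxy) hY
  · exact hε.tendstoInDistribution
      (F := fun n x => (p.Tsum P₀ n x, p.Tlb P₀ n x, p.Tsb P₀ n x))
      (fun n => (hp.measurable_Tsum n).prodMk
        ((hp.measurable_Tlb n).prodMk (hp.measurable_Tsb n)))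
      (fun n x y hxy => by
        simp only [StatParams.dependsOn_Tsum n hxy, StatParams.dependsOn_Tlb n hxy,
          StatParams.dependsOn_Tsb n hxy])
      (hp.tendstoInDistribution_statistics hN hh hs hNlb hLsb hY)
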